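/- Let $(M,I)$ be a complex manifold, and let $E\to M$ and $E'\to M$ be smooth real vector bundles of even rank, equipped with smooth connections $\nabla$ and $\nabla'$ whose curvatures are of type $(1,1)$, i.e. $R(I\cdot,I\cdot)=R(\cdot,\cdot)$. Let $E_{\mathbb C}=E\otimes\mathbb C$ carry the holomorphic structure $\nabla^{0,1}_v=\tfrac12(\nabla_v+i\nabla_{Iv})$, and similarly $E'_{\mathbb C}$ with $\nabla'^{0,1}$. An isomorphism of holomorphic bundles $(E_{\mathbb C},\nabla^{0,1})\to(E'_{\mathbb C},\nabla'^{0,1})$ is a smooth $\mathbb C$-linear bundle isomorphism over $\mathrm{id}_M$ that intertwines $\nabla^{0,1}$ and $\nabla'^{0,1}$. Let $\mathcal C(E)=\{J\in\operatorname{End}E : J^2=-1\}$, a submanifold of the total space of $\operatorname{End}E$, and for a fibre metric $g$ on $E$ let $\mathcal T(E,g)=\{J\in\mathcal C(E): g(J\cdot,J\cdot)=g\}$. These are complex manifolds with the complex structure $\mathcal J^{(\nabla,I)}$, the latter if $\nabla g=0$; at a point $J$ it is given by $\mathcal J^{(\nabla,I)}(B+v^{\nabla})=JB+(Iv)^{\nabla}$,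 where $B$ is a vertical tangent vector and $v^\nabla$ is the horizontal lift, with respect to the connection induced by $\nabla$ on $\operatorname{End}E$, of a tangent vector $v$ of $M$. The same definitions apply to $E'$. For a complex structure $J$ on a fibre of $E$, let $E^{0,1}_J\subset E_{\mathbb C}$ be its $-i$ eigenspace. (1) Let $A:E\to E'$ be a smooth real bundle map over $\mathrm{id}_M$ whose $\mathbb C$-linear extension is an isomorphism of holomorphic bundles $(E_{\mathbb C},\nabla^{0,1})\to(E'_{\mathbb C},\nabla'^{0,1})$. Then $A$ induces a fibre-preserving biholomorphism $\Phi:(\mathcal C(E),\mathcal J^{(\nabla,I)})\to(\mathcal C(E'),\mathcal J^{(\nabla',I)})$, determined by $E'^{0,1}_{\Phi(J)}=A(E^{0,1}_J)$. (2) Let $g$ and $g'$ be smooth fibre metrics on $E$ and $E'$ with $\nabla g=0$ and $\nabla'g'=0$, and let $A:E_{\mathbb C}\to E'_{\mathbb C}$ be an isomorphism of holomorphic bundles $(E_{\mathbb C},\nabla^{0,1})\to(E'_{\mathbb C},\nabla'^{0,1})$, not necessarily the extension of a real map, that is orthogonal for the $\mathbb C$-bilinear extensions of $g$ and $g'$.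 Then $A$ induces, by the same formula $E'^{0,1}_{\Phi(J)}=A(E^{0,1}_J)$, a fibre-preserving biholomorphism $\Phi:(\mathcal T(E,g),\mathcal J^{(\nabla,I)})\to(\mathcal T(E',g'),\mathcal J^{(\nabla',I)})$. -/

import Mathlib

set_option linter.unusedSectionVars false

open Bundle Manifold VectorField
open scoped ContDiff Topology

noncomputable section

namespace TwistorSpaces

/-! ### Subsets of manifolds: tangent vectors, holomorphic maps, biholomorphisms -/

section Subsets

variable {E H W : Type*} [NormedAddCommGroup E] [NormedSpace ℝ E] [TopologicalSpace H]
  [TopologicalSpace W] [ChartedSpace H W]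
  {E' H' W' : Type*} [NormedAddCommGroup E'] [NormedSpace ℝ E'] [TopologicalSpace H']
  [TopologicalSpace W'] [ChartedSpace H' W']

/-- The tangent vectors at `p` of a subset `S` of a manifold `W`: the velocities at time `0` of
the smooth curves in `W` that stay in `S` and pass through `p` at time `0`. For an embedded
submanifold `S` this is the tangent space `T_p S`, as a subset of `T_p W`. -/
def tangentVectors (IW : ModelWithCorners ℝ E H) (S : Set W) (p : W) : Set (TangentSpace IW p) :=
  {X | ∃ c : ℝ → W, ContMDiff 𝓘(ℝ, ℝ) IW ∞ c ∧ (∀ t, c t ∈ S) ∧ c 0 = p ∧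
    X = mfderiv 𝓘(ℝ, ℝ) IW c 0 (1 : ℝ)}

/-- Let `S ⊆ W` and `S' ⊆ W'` be submanifolds whose tangent spaces carry the almost complex
structures obtained by restricting `J` and `J'`. A map `f : S → S'` is holomorphic if it is smooth,
i.e. locally the restriction of a smooth map `G` of the ambient manifolds, and its differential,
i.e. the restriction of `dG` to `T_p S`, intertwines `J` and `J'`. -/
def IsHolomorphic (IW : ModelWithCorners ℝ E H) (IW' : ModelWithCorners ℝ E' H')
    (S : Set W) (J : Π p : W, TangentSpace IW p → TangentSpace IW p)
    (S' : Set W') (J' : Π p : W', TangentSpace IW' p → TangentSpace IW' p) (f : S → S') : Prop :=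
  ∀ p : S, ∃ (U : Set W) (G : W → W'), IsOpen U ∧ (p : W) ∈ U ∧ ContMDiffOn IW IW' ∞ G U ∧
    (∀ q : S, (q : W) ∈ U → G q = f q) ∧
    ∀ X ∈ tangentVectors IW S (p : W),
      mfderiv IW IW' G p (J p X) = J' (G p) (mfderiv IW IW' G p X)

/-- A biholomorphism: a bijection that is holomorphic and has a holomorphic inverse. -/
def IsBiholomorphism (IW : ModelWithCorners ℝ E H) (IW' : ModelWithCorners ℝ E' H')
    (S : Set W) (J : Π p : W, TangentSpace IW p → TangentSpace IW p)
    (S' : Set W') (J' : Π p : W', TangentSpace IW' p → TangentSpace IW' p) (f : S ≃ S') : Prop :=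
  IsHolomorphic IW IW' S J S' J' f ∧ IsHolomorphic IW' IW S' J' S J f.symm

end Subsets

/-! ### Complex structures on the base -/

section Base

variable {EM : Type*} [NormedAddCommGroup EM] [NormedSpace ℝ EM]
  {M : Type*} [TopologicalSpace M] [ChartedSpace EM M] [IsManifold 𝓘(ℝ, EM) ∞ M]

/-- `I` is an integrable (smooth, with vanishing Nijenhuis tensor) complex structure on `M`. -/
structure IsComplexStructure
    (I : Π x : M, TangentSpace 𝓘(ℝ, EM) x →L[ℝ] TangentSpace 𝓘(ℝ, EM) x) : Prop where
  smooth : ContMDiff 𝓘(ℝ, EM) (𝓘(ℝ, EM).prod 𝓘(ℝ, EM →L[ℝ] EM)) ∞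
    (fun x => TotalSpace.mk' (EM →L[ℝ] EM)
      (E := fun x : M => TangentSpace 𝓘(ℝ, EM) x →L[ℝ] TangentSpace 𝓘(ℝ, EM) x) x (I x))
  sq : ∀ x v, I x (I x v) = -v
  nijenhuis : ∀ X Y : Π x : M, TangentSpace 𝓘(ℝ, EM) x,
    ContMDiff 𝓘(ℝ, EM) (𝓘(ℝ, EM).prod 𝓘(ℝ, EM)) ∞ (fun x => TotalSpace.mk' EM x (X x)) →
    ContMDiff 𝓘(ℝ, EM) (𝓘(ℝ, EM).prod 𝓘(ℝ, EM)) ∞ (fun x => TotalSpace.mk' EM x (Y x)) →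
    ∀ x, mlieBracket 𝓘(ℝ, EM) (fun y => I y (X y)) (fun y => I y (Y y)) x
      - I x (mlieBracket 𝓘(ℝ, EM) (fun y => I y (X y)) Y x)
      - I x (mlieBracket 𝓘(ℝ, EM) X (fun y => I y (Y y)) x)
      - mlieBracket 𝓘(ℝ, EM) X Y x = 0

end Base

section Bundles

variable {EM : Type*} [NormedAddCommGroup EM] [NormedSpace ℝ EM]
  {M : Type*} [TopologicalSpace M] [ChartedSpace EM M]
  {F : Type*} [NormedAddCommGroup F] [NormedSpace ℝ F] {V : M → Type*}
  [TopologicalSpace (TotalSpace F V)] [∀ x, AddCommGroup (V x)] [∀ x, Module ℝ (V x)]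
  [∀ x, TopologicalSpace (V x)] [FiberBundle F V] [VectorBundle ℝ F V]
  [∀ x, IsTopologicalAddGroup (V x)] [∀ x, ContinuousSMul ℝ (V x)]

/-! ### Curvature -/

/-- The curvature `R(X, Y) σ = ∇_X ∇_Y σ - ∇_Y ∇_X σ - ∇_[X,Y] σ`. -/
def curvature (cov : CovariantDerivative 𝓘(ℝ, EM) F V) (X Y : Π x : M, TangentSpace 𝓘(ℝ, EM) x)
    (σ : Π x, V x) (x : M) : V x :=
  cov (fun y => cov σ y (Y y)) x (X x) - cov (fun y => cov σ y (X y)) x (Y x)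
    - cov σ x (mlieBracket 𝓘(ℝ, EM) X Y x)

/-- The curvature is of type (1,1): `R(IX, IY) = R(X, Y)`. -/
def HasCurvatureOneOne [IsManifold 𝓘(ℝ, EM) ∞ M] (cov : CovariantDerivative 𝓘(ℝ, EM) F V)
    (I : Π x : M, TangentSpace 𝓘(ℝ, EM) x →L[ℝ] TangentSpace 𝓘(ℝ, EM) x) : Prop :=
  ∀ (X Y : Π x : M, TangentSpace 𝓘(ℝ, EM) x) (σ : Π x, V x),
    ContMDiff 𝓘(ℝ, EM) (𝓘(ℝ, EM).prod 𝓘(ℝ, EM)) ∞ (fun x => TotalSpace.mk' EM x (X x)) →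
    ContMDiff 𝓘(ℝ, EM) (𝓘(ℝ, EM).prod 𝓘(ℝ, EM)) ∞ (fun x => TotalSpace.mk' EM x (Y x)) →
    ContMDiff 𝓘(ℝ, EM) (𝓘(ℝ, EM).prod 𝓘(ℝ, F)) ∞ (fun x => TotalSpace.mk' F x (σ x)) →
    ∀ x, curvature cov (fun y => I y (X y)) (fun y => I y (Y y)) σ x = curvature cov X Y σ x

/-! ### The complexification

The complexification `E_ℂ = E ⊗ ℂ = E ⊕ iE` of a real vector bundle is modelled on the Whitney sum
`E ⊕ E`, the pair `(a, b)` standing for `a + i b`. -/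

/-- Multiplication by `i` on the complexification: `i (a + i b) = -b + i a`. -/
def mulI {W : Type*} [AddCommGroup W] (u : W × W) : W × W := (-u.2, u.1)

/-- The `ℂ`-linear extension of `∇` to sections of the complexification. -/
def covC (cov : CovariantDerivative 𝓘(ℝ, EM) F V) (s : Π x, V x × V x) (x : M)
    (v : TangentSpace 𝓘(ℝ, EM) x) : V x × V x :=
  (cov (fun y => (s y).1) x v, cov (fun y => (s y).2) x v)

/-- The operator `∇^{0,1}` on sections of the complexification:
`∇^{0,1}_v s = ½ (∇_v s + i ∇_{Iv} s)`. -/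
def dbar (cov : CovariantDerivative 𝓘(ℝ, EM) F V)
    (I : Π x : M, TangentSpace 𝓘(ℝ, EM) x →L[ℝ] TangentSpace 𝓘(ℝ, EM) x)
    (s : Π x, V x × V x) (x : M) (v : TangentSpace 𝓘(ℝ, EM) x) : V x × V x :=
  (1 / 2 : ℝ) • (covC cov s x v + mulI (covC cov s x (I x v)))

/-- An isomorphism of holomorphic vector bundles `(E_ℂ, ∇^{0,1}) → (E'_ℂ, ∇'^{0,1})` over `M`: a
smooth fibrewise `ℂ`-linear bijective bundle map that intertwines the two `∂̄`-operators. -/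
structure IsHolomorphicBundleIso
    {F' : Type*} [NormedAddCommGroup F'] [NormedSpace ℝ F'] {V' : M → Type*}
    [TopologicalSpace (TotalSpace F' V')] [∀ x, AddCommGroup (V' x)] [∀ x, Module ℝ (V' x)]
    [∀ x, TopologicalSpace (V' x)] [FiberBundle F' V'] [VectorBundle ℝ F' V']
    [∀ x, IsTopologicalAddGroup (V' x)] [∀ x, ContinuousSMul ℝ (V' x)]
    (cov : CovariantDerivative 𝓘(ℝ, EM) F V) (cov' : CovariantDerivative 𝓘(ℝ, EM) F' V')
    (I : Π x : M, TangentSpace 𝓘(ℝ, EM) x →L[ℝ] TangentSpace 𝓘(ℝ, EM) x)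
    (A : Π x : M, (V x × V x) →L[ℝ] (V' x × V' x)) : Prop where
  smooth : ContMDiff 𝓘(ℝ, EM) (𝓘(ℝ, EM).prod 𝓘(ℝ, (F × F) →L[ℝ] (F' × F'))) ∞
    (fun x => TotalSpace.mk' ((F × F) →L[ℝ] (F' × F'))
      (E := fun x => (V x × V x) →L[ℝ] (V' x × V' x)) x (A x))
  complexLinear : ∀ x u, A x (mulI u) = mulI (A x u)
  bijective : ∀ x, Function.Bijective (A x)
  intertwines : ∀ (s : Π x, V x × V x) (x : M),
    MDifferentiableAt 𝓘(ℝ, EM) (𝓘(ℝ, EM).prod 𝓘(ℝ, F × F))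
      (fun y => TotalSpace.mk' (F × F) (E := fun y => V y × V y) y (s y)) x →
    ∀ v, dbar cov' I (fun y => A y (s y)) x v = A x (dbar cov I s x v)

/-! ### Metrics -/

/-- `∇ g = 0`. -/
def IsMetricConnection (cov : CovariantDerivative 𝓘(ℝ, EM) F V)
    (g : ContMDiffRiemannianMetric 𝓘(ℝ, EM) ∞ F V) : Prop :=
  ∀ (σ τ : Π x, V x) (x : M),
    MDifferentiableAt 𝓘(ℝ, EM) (𝓘(ℝ, EM).prod 𝓘(ℝ, F)) (fun y => TotalSpace.mk' F y (σ y)) x →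
    MDifferentiableAt 𝓘(ℝ, EM) (𝓘(ℝ, EM).prod 𝓘(ℝ, F)) (fun y => TotalSpace.mk' F y (τ y)) x →
    ∀ v : TangentSpace 𝓘(ℝ, EM) x,
      mvfderiv 𝓘(ℝ, EM) (fun y => g.inner y (σ y) (τ y)) x v =
        g.inner x (cov σ x v) (τ x) + g.inner x (σ x) (cov τ x v)

/-- The `ℂ`-bilinear extension of `g` to the complexification. -/
def metricC (g : ContMDiffRiemannianMetric 𝓘(ℝ, EM) ∞ F V) (x : M) (u w : V x × V x) : ℂ :=
  ⟨g.inner x u.1 w.1 - g.inner x u.2 w.2, g.inner x u.1 w.2 + g.inner x u.2 w.1⟩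

/-! ### Twistor spaces -/

variable (F V) in
/-- The total space of the bundle `End E`. -/
abbrev EndTotal : Type _ := TotalSpace (F →L[ℝ] F) (fun x => V x →L[ℝ] V x)

variable (F V) in
/-- The twistor space `𝒞(E) = {J ∈ End E | J² = -1}`, inside the total space of `End E`. -/
def twistorC : Set (EndTotal F V) := {p | ∀ u, p.snd (p.snd u) = -u}

/-- The twistor space `𝒯(E, g) = {J ∈ 𝒞(E) | g(J·, J·) = g(·, ·)}`. -/
def twistorT (g : ContMDiffRiemannianMetric 𝓘(ℝ, EM) ∞ F V) : Set (EndTotal F V) :=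
  {p | p ∈ twistorC F V ∧ ∀ u w, g.inner p.proj (p.snd u) (p.snd w) = g.inner p.proj u w}

/-- The `-i` eigenspace `E^{0,1}_J ⊆ E_ℂ` of (the `ℂ`-linear extension of) `J`. -/
def zeroOneSpace {W : Type*} [AddCommGroup W] [Module ℝ W] [TopologicalSpace W] (J : W →L[ℝ] W) :
    Set (W × W) :=
  {u | (J u.1, J u.2) = -mulI u}

/-! ### The almost complex structure on the twistor space -/

/-- `(∇_v S)(x) = 0` for the connection induced on `End E`, i.e. `∇_v (S s) = S (∇_v s)` at `x` for
all sections `s` of `E`. -/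
def IsParallelAt (cov : CovariantDerivative 𝓘(ℝ, EM) F V) (S : Π x, V x →L[ℝ] V x) (x : M)
    (v : TangentSpace 𝓘(ℝ, EM) x) : Prop :=
  ∀ s : Π y, V y,
    MDifferentiableAt 𝓘(ℝ, EM) (𝓘(ℝ, EM).prod 𝓘(ℝ, F)) (fun y => TotalSpace.mk' F y (s y)) x →
      cov (fun y => S y (s y)) x v = S x (cov s x v)

/-- The vertical tangent vector at `p = (x, A)` given by `B ∈ End E_x`: the velocity of
`t ↦ (x, A + t B)` at time `0`. -/
def verticalVector (p : EndTotal F V) (B : V p.proj →L[ℝ] V p.proj) :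
    TangentSpace (𝓘(ℝ, EM).prod 𝓘(ℝ, F →L[ℝ] F)) p :=
  mfderiv 𝓘(ℝ, ℝ) (𝓘(ℝ, EM).prod 𝓘(ℝ, F →L[ℝ] F))
    (fun t : ℝ => TotalSpace.mk' (F →L[ℝ] F) (E := fun x => V x →L[ℝ] V x) p.proj (p.snd + t • B))
    0 (1 : ℝ)

/-- `h` is the horizontal lift `v^∇` of `v` at `p = (x, A)`: the image of `v` under the differential
at `x` of a section `S` of `End E` with `S(x) = A` that is parallel at `x` in the direction `v`. -/
def IsHorizontalLift (cov : CovariantDerivative 𝓘(ℝ, EM) F V) (p : EndTotal F V)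
    (v : TangentSpace 𝓘(ℝ, EM) p.proj)
    (h : TangentSpace (𝓘(ℝ, EM).prod 𝓘(ℝ, F →L[ℝ] F)) p) : Prop :=
  ∃ S : Π x, V x →L[ℝ] V x, S p.proj = p.snd ∧
    MDifferentiableAt 𝓘(ℝ, EM) (𝓘(ℝ, EM).prod 𝓘(ℝ, F →L[ℝ] F))
      (fun x => TotalSpace.mk' (F →L[ℝ] F) x (S x)) p.proj ∧
    IsParallelAt cov S p.proj v ∧
    h = mfderiv 𝓘(ℝ, EM) (𝓘(ℝ, EM).prod 𝓘(ℝ, F →L[ℝ] F))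
      (fun x => TotalSpace.mk' (F →L[ℝ] F) x (S x)) p.proj v

/-- The graph of `𝒥^{(∇,I)}`: `𝒥 (B + v^∇) = J B + (Iv)^∇` at the point `J` of `End E`, where `B`
is vertical and `v^∇` is the horizontal lift of a tangent vector `v` of the base. -/
def IsTwistorJ (cov : CovariantDerivative 𝓘(ℝ, EM) F V)
    (I : Π x : M, TangentSpace 𝓘(ℝ, EM) x →L[ℝ] TangentSpace 𝓘(ℝ, EM) x)
    (p : EndTotal F V) (X Y : TangentSpace (𝓘(ℝ, EM).prod 𝓘(ℝ, F →L[ℝ] F)) p) : Prop :=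
  ∃ (v : TangentSpace 𝓘(ℝ, EM) p.proj) (B : V p.proj →L[ℝ] V p.proj)
    (h h' : TangentSpace (𝓘(ℝ, EM).prod 𝓘(ℝ, F →L[ℝ] F)) p),
    IsHorizontalLift cov p v h ∧ IsHorizontalLift cov p (I p.proj v) h' ∧
    X = verticalVector p B + h ∧ Y = verticalVector p (p.snd.comp B) + h'

end Bundles

/-! ### The splitting into vertical and horizontal vectors, which makes `𝒥` a function -/

section Splitting

variable {EM : Type*} [NormedAddCommGroup EM] [NormedSpace ℝ EM]
  {M : Type*} [TopologicalSpace M] [ChartedSpace EM M]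
  {F : Type*} [NormedAddCommGroup F] [NormedSpace ℝ F] {V : M → Type*}
  [TopologicalSpace (TotalSpace F V)] [∀ x, AddCommGroup (V x)] [∀ x, Module ℝ (V x)]
  [∀ x, TopologicalSpace (V x)] [FiberBundle F V] [VectorBundle ℝ F V]

theorem mfderiv_totalSpace_apply {N E' H' : Type*} [NormedAddCommGroup E'] [NormedSpace ℝ E']
    [TopologicalSpace H'] {I' : ModelWithCorners ℝ E' H'} [TopologicalSpace N] [ChartedSpace H' N]
    (f : N → TotalSpace F V) (n : N)
    (hf : MDifferentiableAt I' (𝓘(ℝ, EM).prod 𝓘(ℝ, F)) f n) (v : TangentSpace I' n) :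
    (mfderiv I' (𝓘(ℝ, EM).prod 𝓘(ℝ, F)) f n v : EM × F) =
      ((mfderiv I' 𝓘(ℝ, EM) (fun y => (f y).proj) n v : EM),
       (mfderiv I' 𝓘(ℝ, F) (fun y => (trivializationAt F V (f n).proj (f y)).2) n v : F)) := by
  have hf' := hf
  rw [mdifferentiableAt_totalSpace] at hf
  obtain ⟨h1, h2⟩ := hf
  have key : writtenInExtChartAt I' (𝓘(ℝ, EM).prod 𝓘(ℝ, F)) n f
      =ᶠ[𝓝[Set.range I'] (extChartAt I' n n)]
    fun z => (writtenInExtChartAt I' 𝓘(ℝ, EM) n (fun y => (f y).proj) z,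
      writtenInExtChartAt I' 𝓘(ℝ, F) n
        (fun y => (trivializationAt F V (f n).proj (f y)).2) z) := by
    have hs : f ⁻¹' (trivializationAt F V (f n).proj).source ∈ 𝓝 n :=
      hf'.continuousAt.preimage_mem_nhds ((trivializationAt F V (f n).proj).open_source.mem_nhds
        ((trivializationAt F V (f n).proj).mem_source.2
          (FiberBundle.mem_baseSet_trivializationAt' _)))
    have hs' := extChartAt_preimage_mem_nhdsWithin (I := I') (s := Set.univ) (x := n)
      (by simpa using hs)
    rw [Set.preimage_univ, Set.univ_inter] at hs'
    filter_upwards [hs'] with z hz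
    have hz' : f ((extChartAt I' n).symm z) ∈ (trivializationAt F V (f n).proj).source := hz
    simp only [writtenInExtChartAt, FiberBundle.extChartAt, Function.comp]
    simp
    refine ⟨congrArg _ ((trivializationAt F V (f n).proj).coe_fst (by simpa using hz')), rfl⟩
  rw [hf'.mfderiv, h1.mfderiv, h2.mfderiv, key.fderivWithin_eq (key.self_of_nhdsWithin (Set.mem_range_self _)),
    DifferentiableWithinAt.fderivWithin_prodMk]
  · rfl
  · exact h1.differentiableWithinAt_writtenInExtChartAt
  · exact h2.differentiableWithinAt_writtenInExtChartAt
  · exact I'.uniqueDiffOn _ (Set.mem_range_self _)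

variable [FiniteDimensional ℝ F] [∀ x, IsTopologicalAddGroup (V x)]
  [∀ x, ContinuousSMul ℝ (V x)] [IsManifold 𝓘(ℝ, EM) ∞ M] [ContMDiffVectorBundle ∞ F V 𝓘(ℝ, EM)]

theorem mfderiv_coord_eq (cov : CovariantDerivative 𝓘(ℝ, EM) F V) (x : M)
    (v : TangentSpace 𝓘(ℝ, EM) x)
    {σ τ : Π y, V y}
    (hσ : MDifferentiableAt 𝓘(ℝ, EM) (𝓘(ℝ, EM).prod 𝓘(ℝ, F)) (fun y => TotalSpace.mk' F y (σ y)) x)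
    (hτ : MDifferentiableAt 𝓘(ℝ, EM) (𝓘(ℝ, EM).prod 𝓘(ℝ, F)) (fun y => TotalSpace.mk' F y (τ y)) x)
    (h : σ x = τ x) (h' : cov σ x v = cov τ x v) :
    (mfderiv 𝓘(ℝ, EM) 𝓘(ℝ, F)
      (fun y => (trivializationAt F V x (TotalSpace.mk' F y (σ y))).2) x v : F) =
    mfderiv 𝓘(ℝ, EM) 𝓘(ℝ, F)
      (fun y => (trivializationAt F V x (TotalSpace.mk' F y (τ y))).2) x v := by
  set e := trivializationAt F V x
  have hx : x ∈ e.baseSet := FiberBundle.mem_baseSet_trivializationAt' x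
  have hev : ∀ᶠ y in 𝓝 x, y ∈ e.baseSet := e.open_baseSet.mem_nhds hx
  let L := e.continuousLinearEquivAt ℝ x hx
  have hL : ∀ w : V x, L w = (e (TotalSpace.mk' F x w)).2 := fun w => rfl
  let Θ : (Π y, V y) → V x := fun σ => cov σ x v -
    L.symm (mvfderiv 𝓘(ℝ, EM) (fun y => (e (TotalSpace.mk' F y (σ y))).2) x v)
  have hΘ : TensorialAt 𝓘(ℝ, EM) F Θ x := by
    constructor
    · intro f σ hf hσ
      have hc : MDifferentiableAt 𝓘(ℝ, EM) 𝓘(ℝ, F) (fun y => (e (TotalSpace.mk' F y (σ y))).2) x :=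
        (mdifferentiableAt_section _ _).1 hσ
      have : (fun y => (e (TotalSpace.mk' F y ((f • σ) y))).2) =ᶠ[𝓝 x]
          (f • (fun y => (e (TotalSpace.mk' F y (σ y))).2)) := by
        filter_upwards [hev] with y hy
        simpa using (e.linear ℝ hy).map_smul (f y) (σ y)
      simp only [Θ]
      rw [cov.isCovariantDerivativeOnUniv.leibniz hσ hf]
      rw [show mvfderiv 𝓘(ℝ, EM) (fun y => (e (TotalSpace.mk' F y ((f • σ) y))).2) x = mvfderiv 𝓘(ℝ, EM) (f • (fun y => (e (TotalSpace.mk' F y (σ y))).2)) x from by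
        ext w
        exact congrArg (fun T : EM →L[ℝ] F => T w) this.mfderiv_eq]
      rw [mvfderiv_smul hf hc]
      have h1 : L.symm (e (TotalSpace.mk' F x (σ x))).2 = σ x := by rw [← hL]; simp
      simp [h1, smul_sub]
    · intro σ τ hσ hτ
      have hc : MDifferentiableAt 𝓘(ℝ, EM) 𝓘(ℝ, F) (fun y => (e (TotalSpace.mk' F y (σ y))).2) x :=
        (mdifferentiableAt_section _ _).1 hσ
      have hd : MDifferentiableAt 𝓘(ℝ, EM) 𝓘(ℝ, F) (fun y => (e (TotalSpace.mk' F y (τ y))).2) x :=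
        (mdifferentiableAt_section _ _).1 hτ
      have : (fun y => (e (TotalSpace.mk' F y ((σ + τ) y))).2) =ᶠ[𝓝 x]
          ((fun y => (e (TotalSpace.mk' F y (σ y))).2) +
            (fun y => (e (TotalSpace.mk' F y (τ y))).2)) := by
        filter_upwards [hev] with y hy
        simpa using (e.linear ℝ hy).map_add (σ y) (τ y)
      simp only [Θ]
      rw [cov.isCovariantDerivativeOnUniv.add hσ hτ]
      rw [show mvfderiv 𝓘(ℝ, EM) (fun y => (e (TotalSpace.mk' F y ((σ + τ) y))).2) x =
        mvfderiv 𝓘(ℝ, EM) ((fun y => (e (TotalSpace.mk' F y (σ y))).2) +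
            (fun y => (e (TotalSpace.mk' F y (τ y))).2)) x from by
        ext w
        exact congrArg (fun T : EM →L[ℝ] F => T w) this.mfderiv_eq]
      rw [mvfderiv_add hc hd]
      simp
      abel
  have := hΘ.pointwise hσ hτ h
  simp only [Θ, h', sub_right_inj, EmbeddingLike.apply_eq_iff_eq] at this
  exact this

theorem section_fst (S : Π x, V x →L[ℝ] V x) (x : M)
    (hS : MDifferentiableAt 𝓘(ℝ, EM) (𝓘(ℝ, EM).prod 𝓘(ℝ, F →L[ℝ] F))
      (fun x => TotalSpace.mk' (F →L[ℝ] F) x (S x)) x) (v : TangentSpace 𝓘(ℝ, EM) x) :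
    (mfderiv 𝓘(ℝ, EM) (𝓘(ℝ, EM).prod 𝓘(ℝ, F →L[ℝ] F))
      (fun x => TotalSpace.mk' (F →L[ℝ] F) x (S x)) x v : EM × (F →L[ℝ] F)).1 = v := by
  rw [mfderiv_totalSpace_apply _ _ hS]
  exact congrArg (fun T : EM →L[ℝ] EM => T v) (mfderiv_id (I := 𝓘(ℝ, EM)) (x := x))

theorem vertical_apply (p : TotalSpace (F →L[ℝ] F) (fun x => V x →L[ℝ] V x))
    (B : V p.proj →L[ℝ] V p.proj) :
    (verticalVector (EM := EM) p B : EM × (F →L[ℝ] F)) = (0,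
      (trivializationAt (F →L[ℝ] F) (fun x => V x →L[ℝ] V x) p.proj).continuousLinearEquivAt ℝ p.proj
        (FiberBundle.mem_baseSet_trivializationAt' p.proj) B) := by
  set L := (trivializationAt (F →L[ℝ] F) (fun x => V x →L[ℝ] V x) p.proj).continuousLinearEquivAt
    ℝ p.proj (FiberBundle.mem_baseSet_trivializationAt' p.proj) with hLdef
  have hL : (fun t : ℝ => (trivializationAt (F →L[ℝ] F) (fun x => V x →L[ℝ] V x) p.proj
      (TotalSpace.mk' (F →L[ℝ] F) (E := fun x => V x →L[ℝ] V x) p.proj (p.snd + t • B))).2)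
      = fun t => L p.snd + t • L B := by
    ext1 t
    rw [← map_smul, ← map_add]
    rfl
  have hd : HasFDerivAt (fun t : ℝ => L p.snd + t • L B)
      ((ContinuousLinearMap.id ℝ ℝ).smulRight (L B)) 0 :=
    ((ContinuousLinearMap.id ℝ ℝ).smulRight (L B)).hasFDerivAt.const_add _
  have hm : MDifferentiableAt 𝓘(ℝ, ℝ) (𝓘(ℝ, EM).prod 𝓘(ℝ, F →L[ℝ] F))
      (fun t : ℝ => TotalSpace.mk' (F →L[ℝ] F) (E := fun x => V x →L[ℝ] V x) p.proj
        (p.snd + t • B)) 0 := by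
    rw [mdifferentiableAt_totalSpace]
    refine ⟨mdifferentiableAt_const, ?_⟩
    dsimp only
    rw [hL]
    exact hd.differentiableAt.mdifferentiableAt
  unfold verticalVector
  have h0 := mfderiv_totalSpace_apply _ _ hm (1 : ℝ)
  dsimp only at h0
  rw [hL] at h0
  refine h0.trans ?_
  refine Prod.ext ?_ ?_
  · exact congrArg (fun T : ℝ →L[ℝ] EM => T 1)
      (mfderiv_const (I := 𝓘(ℝ, ℝ)) (I' := 𝓘(ℝ, EM)) (x := (0 : ℝ)) (c := p.proj))
  · have := congrArg (fun T : ℝ →L[ℝ] (F →L[ℝ] F) => T 1) hd.hasMFDerivAt.mfderiv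
    simpa using! this

theorem lift_unique (cov : CovariantDerivative 𝓘(ℝ, EM) F V)
    (p : TotalSpace (F →L[ℝ] F) (fun x => V x →L[ℝ] V x))
    (v : TangentSpace 𝓘(ℝ, EM) p.proj)
    (h h' : TangentSpace (𝓘(ℝ, EM).prod 𝓘(ℝ, F →L[ℝ] F)) p)
    (H : IsHorizontalLift cov p v h) (H' : IsHorizontalLift cov p v h') : h = h' := by
  obtain ⟨S, hS, dS, pS, rfl⟩ := H
  obtain ⟨S', hS', dS', pS', rfl⟩ := H'
  obtain ⟨x, A⟩ := p
  dsimp only at hS hS' dS dS' pS pS' v ⊢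
  have hx : x ∈ (trivializationAt F V x).baseSet := FiberBundle.mem_baseSet_trivializationAt' x
  have hev : ∀ᶠ y in 𝓝 x, y ∈ (trivializationAt F V x).baseSet :=
    (trivializationAt F V x).open_baseSet.mem_nhds hx
  have key : ∀ (S : Π x, V x →L[ℝ] V x) (_ : MDifferentiableAt 𝓘(ℝ, EM)
      (𝓘(ℝ, EM).prod 𝓘(ℝ, F →L[ℝ] F)) (fun x => TotalSpace.mk' (F →L[ℝ] F) x (S x)) x) (w : V x),
      (mfderiv 𝓘(ℝ, EM) (𝓘(ℝ, EM).prod 𝓘(ℝ, F →L[ℝ] F))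
        (fun x => TotalSpace.mk' (F →L[ℝ] F) x (S x)) x v : EM × (F →L[ℝ] F)).2
        ((trivializationAt F V x) (TotalSpace.mk' F x w)).2 =
      mfderiv 𝓘(ℝ, EM) 𝓘(ℝ, F) (fun y => (trivializationAt F V x
        (TotalSpace.mk' F y (S y (FiberBundle.extend F w y)))).2) x v := by
    intro S dS w
    rw [mfderiv_totalSpace_apply _ _ dS]
    have hc := (mdifferentiableAt_section _ _).1 dS
    set f := ((trivializationAt F V x) (TotalSpace.mk' F x w)).2 with hf
    have h1 := ((ContinuousLinearMap.apply ℝ F f).hasMFDerivAt (x := _)).comp x hc.hasMFDerivAt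
    have h2 : (fun y => (trivializationAt F V x
        (TotalSpace.mk' F y (S y (FiberBundle.extend F w y)))).2) =ᶠ[𝓝 x]
        (ContinuousLinearMap.apply ℝ F f) ∘ (fun b => (trivializationAt (F →L[ℝ] F)
          (fun x => V x →L[ℝ] V x) x (TotalSpace.mk' (F →L[ℝ] F) b (S b))).2) := by
      filter_upwards [hev] with y hy
      simp only [Function.comp, hom_trivializationAt_apply, ContinuousLinearMap.inCoordinates,
        ContinuousLinearMap.apply_apply, ContinuousLinearMap.comp_apply, FiberBundle.extend]
      rw [Trivialization.continuousLinearMapAt_apply, Trivialization.coe_linearMapAt_of_mem _ hy,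
        Trivialization.symmL_apply _ hy]
    have h3 := (h1.congr_of_eventuallyEq h2).mfderiv
    rw [h3]
    rfl
  have hT : ∀ w : V x, MDifferentiableAt 𝓘(ℝ, EM) (𝓘(ℝ, EM).prod 𝓘(ℝ, F))
      (fun y => TotalSpace.mk' F y (FiberBundle.extend F w y)) x :=
    fun w => FiberBundle.mdifferentiableAt_extend 𝓘(ℝ, EM) F w
  refine Prod.ext ?_ ?_
  · exact (section_fst S x dS v).trans (section_fst S' x dS' v).symm
  · refine ContinuousLinearMap.ext fun f => ?_
    obtain ⟨w, rfl⟩ : ∃ w : V x, ((trivializationAt F V x) (TotalSpace.mk' F x w)).2 = f :=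
      ((trivializationAt F V x).continuousLinearEquivAt ℝ x hx).surjective f
    refine (key S dS w).trans (Eq.trans ?_ (key S' dS' w).symm)
    refine mfderiv_coord_eq cov x v (dS.clm_bundle_apply (hT w)) (dS'.clm_bundle_apply (hT w)) ?_ ?_
    · rw [hS, hS']
    · rw [pS _ (hT w), pS' _ (hT w), hS, hS']

theorem lift_exists (cov : CovariantDerivative 𝓘(ℝ, EM) F V)
    (p : TotalSpace (F →L[ℝ] F) (fun x => V x →L[ℝ] V x))
    (v : TangentSpace 𝓘(ℝ, EM) p.proj) : ∃ h, IsHorizontalLift cov p v h := by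
  obtain ⟨x, A⟩ := p
  dsimp only at v
  let S₀ : Π y, V y →L[ℝ] V y := FiberBundle.extend (F →L[ℝ] F) (E := fun x => V x →L[ℝ] V x) A
  have hS₀ : S₀ x = A := FiberBundle.extend_apply_self (F →L[ℝ] F) (E := fun x => V x →L[ℝ] V x) A
  have dS₀ : MDifferentiableAt 𝓘(ℝ, EM) (𝓘(ℝ, EM).prod 𝓘(ℝ, F →L[ℝ] F))
      (fun x => TotalSpace.mk' (F →L[ℝ] F) x (S₀ x)) x :=
    FiberBundle.mdifferentiableAt_extend 𝓘(ℝ, EM) (F →L[ℝ] F) (V := fun x => V x →L[ℝ] V x) A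
  by_cases hv : v = 0
  · exact ⟨_, S₀, hS₀, dS₀, fun s _ => by simp [hv], rfl⟩
  have hten : TensorialAt 𝓘(ℝ, EM) F
      (fun s => cov (fun y => S₀ y (s y)) x v - S₀ x (cov s x v)) x := by
    constructor
    · intro f s hf hs
      have h1 : (fun y => S₀ y ((f • s) y)) = f • (fun y => S₀ y (s y)) := by
        ext y; simp
      rw [h1, cov.isCovariantDerivativeOnUniv.leibniz (dS₀.clm_bundle_apply hs) hf,
        cov.isCovariantDerivativeOnUniv.leibniz hs hf]
      simp [smul_sub]
    · intro s t hs ht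
      have h1 : (fun y => S₀ y ((s + t) y)) = (fun y => S₀ y (s y)) + (fun y => S₀ y (t y)) := by
        ext y; simp
      rw [h1, cov.isCovariantDerivativeOnUniv.add (dS₀.clm_bundle_apply hs)
        (dS₀.clm_bundle_apply ht), cov.isCovariantDerivativeOnUniv.add hs ht]
      simp
      abel
  let T : V x →L[ℝ] V x := hten.mkHom
  have hTs : ∀ s : Π y, V y, MDifferentiableAt 𝓘(ℝ, EM) (𝓘(ℝ, EM).prod 𝓘(ℝ, F))
      (fun y => TotalSpace.mk' F y (s y)) x →
      T (s x) = cov (fun y => S₀ y (s y)) x v - S₀ x (cov s x v) :=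
    fun s hs => TensorialAt.mkHom_apply hten hs
  let S₁ : Π y, V y →L[ℝ] V y := FiberBundle.extend (F →L[ℝ] F) (E := fun x => V x →L[ℝ] V x) T
  have hS₁ : S₁ x = T := FiberBundle.extend_apply_self (F →L[ℝ] F) (E := fun x => V x →L[ℝ] V x) T
  have dS₁ : MDifferentiableAt 𝓘(ℝ, EM) (𝓘(ℝ, EM).prod 𝓘(ℝ, F →L[ℝ] F))
      (fun x => TotalSpace.mk' (F →L[ℝ] F) x (S₁ x)) x :=
    FiberBundle.mdifferentiableAt_extend 𝓘(ℝ, EM) (F →L[ℝ] F) (V := fun x => V x →L[ℝ] V x) T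
  obtain ⟨g, hg0, dg, hg1⟩ : ∃ g : M → ℝ, g x = 0 ∧ MDifferentiableAt 𝓘(ℝ, EM) 𝓘(ℝ, ℝ) g x ∧
      mvfderiv 𝓘(ℝ, EM) g x v = 1 := by
    have hv' : (id v : EM) ≠ 0 := hv
    obtain ⟨l, hl⟩ := SeparatingDual.exists_eq_one (R := ℝ) hv'
    have hd := mdifferentiableAt_extChartAt (I := 𝓘(ℝ, EM)) (mem_chart_source EM x)
    have h1 := (l.hasMFDerivAt (x := _)).comp x hd.hasMFDerivAt
    rw [mfderiv_extChartAt_self] at h1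
    have h2 := h1.sub (hasMFDerivAt_const (I := 𝓘(ℝ, EM)) (I' := 𝓘(ℝ, ℝ)) (l (extChartAt 𝓘(ℝ, EM) x x)) x)
    refine ⟨_, ?_, h2.mdifferentiableAt, ?_⟩
    · simp
    · refine (congrArg (fun T : EM →L[ℝ] ℝ => T v) h2.mfderiv).trans ?_
      exact (sub_zero (l v)).trans hl
  have dg₁ := dg.smul_section dS₁
  have dS : MDifferentiableAt 𝓘(ℝ, EM) (𝓘(ℝ, EM).prod 𝓘(ℝ, F →L[ℝ] F))
      (fun x => TotalSpace.mk' (F →L[ℝ] F) x ((S₀ - g • S₁) x)) x :=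
    mdifferentiableAt_sub_section dS₀ dg₁
  refine ⟨_, S₀ - g • S₁, by simp [hS₀, hg0], dS, fun s hs => ?_, rfl⟩
  have h1 : (fun y => S₀ y (s y)) = (fun y => (S₀ - g • S₁) y (s y)) + g • (fun y => S₁ y (s y)) := by
    ext y; simp
  have h2 := congrArg (fun L : EM →L[ℝ] V x => L v) (cov.isCovariantDerivativeOnUniv.add
    (dS.clm_bundle_apply hs) (dg.smul_section (dS₁.clm_bundle_apply hs)))
  have h3 := congrArg (fun L : EM →L[ℝ] V x => L v)
    (cov.isCovariantDerivativeOnUniv.leibniz (dS₁.clm_bundle_apply hs) dg)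
  have h4 := hTs s hs
  have h5 : cov (fun y => S₀ y (s y)) x v = cov (fun y => (S₀ - g • S₁) y (s y)) x v
      + cov (g • (fun y => S₁ y (s y))) x v := by
    rw [h1]; exact h2
  have h6 : cov (g • (fun y => S₁ y (s y))) x v = T (s x) := by
    refine h3.trans ?_
    rw [hg0, hS₁]
    simp only [zero_smul, zero_add]
    exact (congrArg (fun r : ℝ => r • T (s x)) hg1).trans (one_smul ℝ (T (s x)))
  rw [h5, h6, hS₀] at h4
  have h7 : (S₀ - g • S₁) x = A := by simp [hS₀, hg0]
  rw [h7]
  have h8 := eq_sub_iff_add_eq.1 h4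
  rw [add_comm] at h8
  exact (add_right_cancel h8).symm

theorem lift_fst (cov : CovariantDerivative 𝓘(ℝ, EM) F V)
    (p : TotalSpace (F →L[ℝ] F) (fun x => V x →L[ℝ] V x))
    (v : TangentSpace 𝓘(ℝ, EM) p.proj)
    (h : TangentSpace (𝓘(ℝ, EM).prod 𝓘(ℝ, F →L[ℝ] F)) p)
    (H : IsHorizontalLift cov p v h) : (h : EM × (F →L[ℝ] F)).1 = v := by
  obtain ⟨S, hS, dS, pS, rfl⟩ := H
  exact section_fst S _ dS v

theorem existsUnique_twistorJ (cov : CovariantDerivative 𝓘(ℝ, EM) F V)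
    (I : Π x : M, TangentSpace 𝓘(ℝ, EM) x →L[ℝ] TangentSpace 𝓘(ℝ, EM) x)
    (p : TotalSpace (F →L[ℝ] F) (fun x => V x →L[ℝ] V x))
    (X : TangentSpace (𝓘(ℝ, EM).prod 𝓘(ℝ, F →L[ℝ] F)) p) : ∃! Y, IsTwistorJ cov I p X Y := by
  obtain ⟨h, H⟩ := lift_exists cov p (X : EM × (F →L[ℝ] F)).1
  obtain ⟨h', H'⟩ := lift_exists cov p (I p.proj (X : EM × (F →L[ℝ] F)).1)
  set L := (trivializationAt (F →L[ℝ] F) (fun x => V x →L[ℝ] V x) p.proj).continuousLinearEquivAt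
    ℝ p.proj (FiberBundle.mem_baseSet_trivializationAt' p.proj) with hL
  refine ⟨_, ⟨_, L.symm ((X : EM × (F →L[ℝ] F)).2 - (h : EM × (F →L[ℝ] F)).2), h, h', H, H', ?_,
    rfl⟩, ?_⟩
  · refine Prod.ext ?_ ?_
    · refine Eq.trans ?_ (congrArg (fun q : EM × (F →L[ℝ] F) => q.1 + (h : EM × (F →L[ℝ] F)).1)
        (vertical_apply p _)).symm
      simp [lift_fst cov p _ h H]
    · refine Eq.trans ?_ (congrArg (fun q : EM × (F →L[ℝ] F) => q.2 + (h : EM × (F →L[ℝ] F)).2)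
        (vertical_apply p _)).symm
      simp [← hL]
  · rintro Y ⟨v, B, k, k', K, K', hX, rfl⟩
    have hv : (X : EM × (F →L[ℝ] F)).1 = v := by
      have := congrArg (fun q : EM × (F →L[ℝ] F) => q.1) hX
      refine this.trans ((congrArg (fun q : EM × (F →L[ℝ] F) => q.1 + (k : EM × (F →L[ℝ] F)).1)
        (vertical_apply p _)).trans ?_)
      simp only [lift_fst cov p _ k K]
      exact zero_add _
    subst hv
    obtain rfl := lift_unique cov p _ _ _ H K
    obtain rfl := lift_unique cov p _ _ _ H' K'
    have hB : (X : EM × (F →L[ℝ] F)).2 = L B + (h : EM × (F →L[ℝ] F)).2 := by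
      have := congrArg (fun q : EM × (F →L[ℝ] F) => q.2) hX
      exact this.trans (congrArg (fun q : EM × (F →L[ℝ] F) => q.2 + (h : EM × (F →L[ℝ] F)).2)
        (vertical_apply p _))
    have hB' : B = L.symm ((X : EM × (F →L[ℝ] F)).2 - (h : EM × (F →L[ℝ] F)).2) := by
      rw [hB]; simp
    rw [hB']

/-- The structure `𝒥^{(∇,I)}`. On tangent vectors of `𝒞(E)` it is the almost complex structure of the
twistor space. -/
def twistorJ (cov : CovariantDerivative 𝓘(ℝ, EM) F V)
    (I : Π x : M, TangentSpace 𝓘(ℝ, EM) x →L[ℝ] TangentSpace 𝓘(ℝ, EM) x)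
    (p : EndTotal F V) (X : TangentSpace (𝓘(ℝ, EM).prod 𝓘(ℝ, F →L[ℝ] F)) p) :
    TangentSpace (𝓘(ℝ, EM).prod 𝓘(ℝ, F →L[ℝ] F)) p :=
  Classical.choose (existsUnique_twistorJ cov I p X).exists

theorem twistorJ_spec (cov : CovariantDerivative 𝓘(ℝ, EM) F V)
    (I : Π x : M, TangentSpace 𝓘(ℝ, EM) x →L[ℝ] TangentSpace 𝓘(ℝ, EM) x)
    (p : EndTotal F V) (X : TangentSpace (𝓘(ℝ, EM).prod 𝓘(ℝ, F →L[ℝ] F)) p) :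
    IsTwistorJ cov I p X (twistorJ cov I p X) :=
  Classical.choose_spec (existsUnique_twistorJ cov I p X).exists

end Splitting

section Induced

variable {M : Type*} {F : Type*} [NormedAddCommGroup F] [NormedSpace ℝ F] {V : M → Type*}
  [∀ x, AddCommGroup (V x)] [∀ x, Module ℝ (V x)] [∀ x, TopologicalSpace (V x)]
  {F' : Type*} [NormedAddCommGroup F'] [NormedSpace ℝ F'] {V' : M → Type*}
  [∀ x, AddCommGroup (V' x)] [∀ x, Module ℝ (V' x)] [∀ x, TopologicalSpace (V' x)]

/-- `Φ` preserves the fibres and is induced by `A : E_ℂ → E'_ℂ`: it sends `J ∈ End E_x` to the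
`J' ∈ End E'_x` with `E'^{0,1}_{J'} = A (E^{0,1}_J)`. -/
def IsInducedBy {S : Set (EndTotal F V)} {S' : Set (EndTotal F' V')}
    (A : Π x : M, (V x × V x) →L[ℝ] (V' x × V' x)) (Φ : S ≃ S') : Prop :=
  ∀ p : S, ∃ J' : V' p.1.proj →L[ℝ] V' p.1.proj,
    (Φ p : EndTotal F' V') = ⟨p.1.proj, J'⟩ ∧
      zeroOneSpace J' = A p.1.proj '' zeroOneSpace p.1.snd

end Induced

end TwistorSpaces

end

open TwistorSpaces

/-!
An isomorphism `A : E_ℂ → E'_ℂ` of the complexifications, written as `A = P + i Q` with real bundle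
maps `P` and `Q`, acts on complex structures by a fractional linear map. For a complex structure `J`
the space `E^{0,1}_J` consists of the vectors `u + i J u`, so it is the graph of `J` in
`E_ℂ = E ⊕ iE`, and `A (u + i J u) = (P - Q J) u + i (Q + P J) u`. As long as `P - Q J` is
invertible, `A (E^{0,1}_J)` is therefore the graph of `J' = (Q + P J) (P - Q J)⁻¹` (`mobius`). It is
invariant under `i`, hence `J'² = -1` and `A (E^{0,1}_J) = E'^{0,1}_{J'}` (`mobius_sq`,
`zeroOneSpace_mobius`). For a real `A` one has `Q = 0` and `J' = A J A⁻¹`. For an orthogonal `A`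
and an orthogonal `J`, the space `A (E^{0,1}_J)` is isotropic, and positivity of `g'` makes
`P - Q J` injective (`injective_denom_of_orthogonal`). The formula for `J'` makes sense on an open
subset of the total space of `End E` and depends smoothly on the point (`contMDiffAt_mobiusMap`).

The differential of `G : J ↦ J'` is computed on vertical and on horizontal vectors. With
`ℓ (a + i b) = b - J' a`, which vanishes on `A (E^{0,1}_J)` and satisfies `ℓ ∘ i = J' ∘ ℓ`,

* `dG` sends a vertical `B` to the vertical `C` with `C (P - Q J) u = ℓ (A (i B u))`
  (`mfderiv_mobiusMap_verticalVector`);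
* `dG` sends the horizontal lift of `v` to the horizontal lift of `v` plus the vertical `D` with
  `D (P - Q J) u = ℓ ((∇_v A) (u + i J u))` (`mfderiv_mobiusMap_horizontalLift`).

That `A` intertwines the `∂̄`-operators means `∇_{Iv} A = i ∇_v A`
(`IsHolomorphicBundleIso.covHom_apply`). So replacing `(B, v)` by `(J B, I v)` replaces `C + D` by
`J' (C + D)`: the differential intertwines `𝒥^{(∇,I)}` and `𝒥^{(∇',I)}`
(`mfderiv_mobiusMap_twistorJ`). The inverse of `A` is again an isomorphism of holomorphic bundles and
induces the inverse of `G`.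
-/

noncomputable section

namespace TwistorSpaces

/-! ### Fractional linear maps on complex structures -/

section LinearAlgebra

open ContinuousLinearMap

variable {W : Type*} [AddCommGroup W] [Module ℝ W] [TopologicalSpace W]
  {W' : Type*} [AddCommGroup W'] [Module ℝ W'] [TopologicalSpace W']

/-! A pair `(a, b)` stands for `a + i b`; a `ℂ`-linear map `A = P + i Q` sends it to
`(P a - Q b, Q a + P b)`. -/

/-- The denominator `P - Q J` of the fractional linear map given by `A = P + i Q`. -/
def denom (A : (W × W) →L[ℝ] (W' × W')) (J : W →L[ℝ] W) : W →L[ℝ] W' :=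
  (fst ℝ W' W').comp (A.comp ((ContinuousLinearMap.id ℝ W).prod J))

/-- The numerator `Q + P J` of the fractional linear map given by `A = P + i Q`. -/
def numer (A : (W × W) →L[ℝ] (W' × W')) (J : W →L[ℝ] W) : W →L[ℝ] W' :=
  (snd ℝ W' W').comp (A.comp ((ContinuousLinearMap.id ℝ W).prod J))

/-- The endomorphism `(Q + P J) (P - Q J)⁻¹`, whose graph is the image under `A = P + i Q` of the
graph of `J`. It is `0` when the denominator is not invertible. -/
def mobius (A : (W × W) →L[ℝ] (W' × W')) (J : W →L[ℝ] W) : W' →L[ℝ] W' :=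
  (numer A J).comp (denom A J).inverse

theorem apply_graph (A : (W × W) →L[ℝ] (W' × W')) (J : W →L[ℝ] W) (u : W) :
    A (u, J u) = (denom A J u, numer A J u) := rfl

theorem mobius_denom {A : (W × W) →L[ℝ] (W' × W')} {J : W →L[ℝ] W}
    (h : (denom A J).IsInvertible) (u : W) : mobius A J (denom A J u) = numer A J u := by
  simp [mobius, h.inverse_apply_self]

theorem mem_zeroOneSpace_iff {J : W →L[ℝ] W} (hJ : ∀ u, J (J u) = -u) (u : W × W) :
    u ∈ zeroOneSpace J ↔ u.2 = J u.1 := by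
  obtain ⟨a, b⟩ := u
  simp only [zeroOneSpace, mulI, Set.mem_ofPred_eq, Prod.neg_mk, neg_neg, Prod.mk.injEq]
  constructor
  · exact fun h => h.1.symm
  · rintro rfl
    exact ⟨rfl, hJ a⟩

/-- A complex structure is determined by its `-i` eigenspace. -/
theorem eq_of_zeroOneSpace_eq {J K : W →L[ℝ] W} (hJ : ∀ u, J (J u) = -u)
    (hK : ∀ u, K (K u) = -u) (h : zeroOneSpace J = zeroOneSpace K) : J = K := by
  ext u
  have h1 : (u, J u) ∈ zeroOneSpace J := (mem_zeroOneSpace_iff hJ _).2 rfl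
  rw [h] at h1
  exact (mem_zeroOneSpace_iff hK _).1 h1

/-- Since `A` commutes with `i` and the graph of `J` is `i`-invariant, so is the graph of
`mobius A J`; this says that `mobius A J` is a complex structure. -/
theorem mobius_sq {A : (W × W) →L[ℝ] (W' × W')} {J : W →L[ℝ] W}
    (hA : ∀ u, A (mulI u) = mulI (A u)) (h : (denom A J).IsInvertible)
    (hJ : ∀ u, J (J u) = -u) (w : W') : mobius A J (mobius A J w) = -w := by
  obtain ⟨u, rfl⟩ := h.surjective w
  have h1 : denom A J (J u) = numer A J u ∧ numer A J (J u) = -denom A J u := by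
    have h2 := hA (u, J u)
    have h3 : mulI (u, J u) = -(J u, J (J u)) := by simp [mulI, hJ]
    rw [h3, map_neg, apply_graph, apply_graph] at h2
    simp only [mulI, Prod.neg_mk, Prod.mk.injEq, neg_inj] at h2
    exact ⟨h2.1, by rw [← h2.2, neg_neg]⟩
  rw [mobius_denom h, ← h1.1, mobius_denom h, h1.2]

theorem zeroOneSpace_mobius {A : (W × W) →L[ℝ] (W' × W')} {J : W →L[ℝ] W}
    (hA : ∀ u, A (mulI u) = mulI (A u)) (h : (denom A J).IsInvertible)
    (hJ : ∀ u, J (J u) = -u) : zeroOneSpace (mobius A J) = A '' zeroOneSpace J := by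
  ext ⟨a, b⟩
  rw [mem_zeroOneSpace_iff (mobius_sq hA h hJ)]
  constructor
  · intro hb
    obtain ⟨u, rfl⟩ := h.surjective a
    refine ⟨(u, J u), (mem_zeroOneSpace_iff hJ _).2 rfl, ?_⟩
    rw [apply_graph]
    simp only [mobius_denom h] at hb
    rw [hb]
  · rintro ⟨⟨u, v⟩, hu, huv⟩
    obtain rfl : v = J u := (mem_zeroOneSpace_iff hJ _).1 hu
    rw [apply_graph, Prod.mk.injEq] at huv
    obtain ⟨rfl, rfl⟩ := huv
    exact (mobius_denom h u).symm

variable [IsTopologicalAddGroup W] [ContinuousSMul ℝ W] [T2Space W] [FiniteDimensional ℝ W]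
  [IsTopologicalAddGroup W'] [ContinuousSMul ℝ W'] [T2Space W'] [FiniteDimensional ℝ W']

theorem isInvertible_of_bijective {f : W →L[ℝ] W'} (hf : Function.Bijective f) :
    f.IsInvertible :=
  ⟨(LinearEquiv.ofBijective (f : W →ₗ[ℝ] W') hf).toContinuousLinearEquiv, rfl⟩

/-- The dimensions of `W` and `W'` agree, since those of `W × W` and `W' × W'` do. -/
theorem isInvertible_denom {A : (W × W) →L[ℝ] (W' × W')} (hA : Function.Bijective A)
    {J : W →L[ℝ] W} (h : Function.Injective (denom A J)) : (denom A J).IsInvertible := by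
  have h1 := (LinearEquiv.ofBijective (A : (W × W) →ₗ[ℝ] (W' × W')) hA).finrank_eq
  rw [Module.finrank_prod, Module.finrank_prod] at h1
  refine isInvertible_of_bijective ⟨h, ?_⟩
  exact (LinearMap.injective_iff_surjective_of_finrank_eq_finrank
    (f := (denom A J : W →ₗ[ℝ] W')) (by lia)).1 h

end LinearAlgebra

/-! ### Smoothness in bundles of homomorphisms -/

section Smooth

open ContinuousLinearMap

variable {EM : Type*} [NormedAddCommGroup EM] [NormedSpace ℝ EM]
  {M : Type*} [TopologicalSpace M] [ChartedSpace EM M]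
  {F : Type*} [NormedAddCommGroup F] [NormedSpace ℝ F] {V : M → Type*}
  [TopologicalSpace (TotalSpace F V)] [∀ x, AddCommGroup (V x)] [∀ x, Module ℝ (V x)]
  [∀ x, TopologicalSpace (V x)] [FiberBundle F V] [VectorBundle ℝ F V]
  {F' : Type*} [NormedAddCommGroup F'] [NormedSpace ℝ F'] {V' : M → Type*}
  [TopologicalSpace (TotalSpace F' V')] [∀ x, AddCommGroup (V' x)] [∀ x, Module ℝ (V' x)]
  [∀ x, TopologicalSpace (V' x)] [FiberBundle F' V'] [VectorBundle ℝ F' V']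

theorem inverse_inCoordinates {x₀ x : M} (hx : x ∈ (trivializationAt F V x₀).baseSet)
    (hx' : x ∈ (trivializationAt F' V' x₀).baseSet) (φ : V x →L[ℝ] V' x) :
    (inCoordinates F V F' V' x₀ x x₀ x φ).inverse =
      inCoordinates F' V' F V x₀ x x₀ x φ.inverse := by
  rw [inCoordinates_eq hx hx', inCoordinates_eq hx' hx, inverse_equiv_comp, inverse_comp_equiv]
  rfl

theorem isInvertible_inCoordinates {x₀ x : M} (hx : x ∈ (trivializationAt F V x₀).baseSet)
    (hx' : x ∈ (trivializationAt F' V' x₀).baseSet) (φ : V x →L[ℝ] V' x) :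
    (inCoordinates F V F' V' x₀ x x₀ x φ).IsInvertible ↔ φ.IsInvertible := by
  rw [inCoordinates_eq hx hx', isInvertible_equiv_comp, isInvertible_comp_equiv]

variable [∀ x, IsTopologicalAddGroup (V x)] [∀ x, ContinuousSMul ℝ (V x)]
  [∀ x, IsTopologicalAddGroup (V' x)] [∀ x, ContinuousSMul ℝ (V' x)]

/-- The trivialization of a Whitney sum is the product of the trivializations of the summands. -/
theorem inCoordinates_prod {x₀ x : M} (hx : x ∈ (trivializationAt F V x₀).baseSet)
    (hx' : x ∈ (trivializationAt F' V' x₀).baseSet) (A : (V x × V x) →L[ℝ] (V' x × V' x)) :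
    inCoordinates (F × F) (fun x => V x × V x) (F' × F') (fun x => V' x × V' x) x₀ x x₀ x A =
      (((trivializationAt F' V' x₀).continuousLinearEquivAt ℝ x hx').prodCongr
        ((trivializationAt F' V' x₀).continuousLinearEquivAt ℝ x hx') : _ →L[ℝ] _) ∘L A ∘L
      ((((trivializationAt F V x₀).continuousLinearEquivAt ℝ x hx).prodCongr
        ((trivializationAt F V x₀).continuousLinearEquivAt ℝ x hx)).symm : _ →L[ℝ] _) := by
  rw [inCoordinates_eq (E := fun x => V x × V x) (E' := fun x => V' x × V' x) (x := x) (y := x)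
    (show x ∈ (trivializationAt (F × F) (fun x => V x × V x) x₀).baseSet from ⟨hx, hx⟩)
    (show x ∈ (trivializationAt (F' × F') (fun x => V' x × V' x) x₀).baseSet from ⟨hx', hx'⟩)]
  rw [← Bundle.Trivialization.continuousLinearEquivAt_prod (𝕜 := ℝ) (show x ∈
      ((trivializationAt F V x₀).prod (trivializationAt F V x₀)).baseSet from ⟨hx, hx⟩),
    ← Bundle.Trivialization.continuousLinearEquivAt_prod (𝕜 := ℝ) (show x ∈
      ((trivializationAt F' V' x₀).prod (trivializationAt F' V' x₀)).baseSet from ⟨hx', hx'⟩)]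
  rfl

theorem denom_inCoordinates {x₀ x : M} (hx : x ∈ (trivializationAt F V x₀).baseSet)
    (hx' : x ∈ (trivializationAt F' V' x₀).baseSet) (A : (V x × V x) →L[ℝ] (V' x × V' x))
    (J : V x →L[ℝ] V x) :
    inCoordinates F V F' V' x₀ x x₀ x (denom A J) =
      denom (inCoordinates (F × F) (fun x => V x × V x) (F' × F') (fun x => V' x × V' x)
        x₀ x x₀ x A) (inCoordinates F V F V x₀ x x₀ x J) := by
  rw [inCoordinates_eq hx hx', inCoordinates_prod hx hx', inCoordinates_eq hx hx]
  generalize (trivializationAt F V x₀).continuousLinearEquivAt ℝ x hx = e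
  ext f
  simp [denom]

theorem numer_inCoordinates {x₀ x : M} (hx : x ∈ (trivializationAt F V x₀).baseSet)
    (hx' : x ∈ (trivializationAt F' V' x₀).baseSet) (A : (V x × V x) →L[ℝ] (V' x × V' x))
    (J : V x →L[ℝ] V x) :
    inCoordinates F V F' V' x₀ x x₀ x (numer A J) =
      numer (inCoordinates (F × F) (fun x => V x × V x) (F' × F') (fun x => V' x × V' x)
        x₀ x x₀ x A) (inCoordinates F V F V x₀ x x₀ x J) := by
  rw [inCoordinates_eq hx hx', inCoordinates_prod hx hx', inCoordinates_eq hx hx]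
  generalize (trivializationAt F V x₀).continuousLinearEquivAt ℝ x hx = e
  ext f
  simp [numer]

/-- Forming the fractional linear map commutes with passing to local trivializations. -/
theorem mobius_inCoordinates {x₀ x : M} (hx : x ∈ (trivializationAt F V x₀).baseSet)
    (hx' : x ∈ (trivializationAt F' V' x₀).baseSet) (A : (V x × V x) →L[ℝ] (V' x × V' x))
    (J : V x →L[ℝ] V x) :
    inCoordinates F' V' F' V' x₀ x x₀ x (mobius A J) =
      mobius (inCoordinates (F × F) (fun x => V x × V x) (F' × F') (fun x => V' x × V' x)
        x₀ x x₀ x A) (inCoordinates F V F V x₀ x x₀ x J) := by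
  rw [mobius, mobius, ← denom_inCoordinates hx hx', ← numer_inCoordinates hx hx',
    inverse_inCoordinates hx hx', inCoordinates_eq hx' hx', inCoordinates_eq hx hx',
    inCoordinates_eq hx' hx]
  generalize (trivializationAt F V x₀).continuousLinearEquivAt ℝ x hx = e
  ext f
  simp

variable [CompleteSpace F]

/-- The inverse of a smooth bundle isomorphism is smooth. -/
theorem contMDiff_inverse_section [IsManifold 𝓘(ℝ, EM) ∞ M]
    [ContMDiffVectorBundle ∞ F V 𝓘(ℝ, EM)] [ContMDiffVectorBundle ∞ F' V' 𝓘(ℝ, EM)]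
    {A : Π x : M, V x →L[ℝ] V' x}
    (hA : ContMDiff 𝓘(ℝ, EM) (𝓘(ℝ, EM).prod 𝓘(ℝ, F →L[ℝ] F')) ∞
      (fun x => TotalSpace.mk' (F →L[ℝ] F') (E := fun x => V x →L[ℝ] V' x) x (A x)))
    (hinv : ∀ x, (A x).IsInvertible) :
    ContMDiff 𝓘(ℝ, EM) (𝓘(ℝ, EM).prod 𝓘(ℝ, F' →L[ℝ] F)) ∞
      (fun x => TotalSpace.mk' (F' →L[ℝ] F) (E := fun x => V' x →L[ℝ] V x) x (A x).inverse) := by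
  intro x₀
  have h0 := ((contMDiffAt_hom_bundle _).1 (hA x₀)).2
  dsimp only at h0
  rw [contMDiffAt_hom_bundle]
  refine ⟨contMDiffAt_id, ?_⟩
  dsimp only
  have hx := FiberBundle.mem_baseSet_trivializationAt F V x₀
  have hx' := FiberBundle.mem_baseSet_trivializationAt F' V' x₀
  have h1 := (((isInvertible_inCoordinates hx hx' _).2 (hinv x₀)).contDiffAt_map_inverse
    (n := ∞)).contMDiffAt.comp x₀ h0
  refine h1.congr_of_eventuallyEq ?_
  filter_upwards [(trivializationAt F V x₀).open_baseSet.mem_nhds hx,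
    (trivializationAt F' V' x₀).open_baseSet.mem_nhds hx'] with x hy hy'
  exact (inverse_inCoordinates hy hy' _).symm

variable (F F') in
/-- The map of endomorphism bundles that is given on the fibres by the fractional linear maps of
`A`; where a denominator is not invertible, its value is the zero endomorphism. -/
def mobiusMap (A : Π x : M, (V x × V x) →L[ℝ] (V' x × V' x)) (p : EndTotal F V) :
    EndTotal F' V' :=
  ⟨p.proj, mobius (A p.proj) p.snd⟩

theorem contMDiffAt_denom_numer_inCoordinates [IsManifold 𝓘(ℝ, EM) ∞ M]
    [ContMDiffVectorBundle ∞ F V 𝓘(ℝ, EM)] [ContMDiffVectorBundle ∞ F' V' 𝓘(ℝ, EM)]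
    {A : Π x : M, (V x × V x) →L[ℝ] (V' x × V' x)}
    (hA : ContMDiff 𝓘(ℝ, EM) (𝓘(ℝ, EM).prod 𝓘(ℝ, (F × F) →L[ℝ] (F' × F'))) ∞
      (fun x => TotalSpace.mk' ((F × F) →L[ℝ] (F' × F'))
        (E := fun x => (V x × V x) →L[ℝ] (V' x × V' x)) x (A x))) (p₀ : EndTotal F V) :
    ContMDiffAt (𝓘(ℝ, EM).prod 𝓘(ℝ, F →L[ℝ] F)) 𝓘(ℝ, F →L[ℝ] F') ∞
      (fun p : EndTotal F V => denom (inCoordinates (F × F) (fun x => V x × V x) (F' × F')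
        (fun x => V' x × V' x) p₀.proj p.proj p₀.proj p.proj (A p.proj))
        (inCoordinates F V F V p₀.proj p.proj p₀.proj p.proj p.snd)) p₀ ∧
    ContMDiffAt (𝓘(ℝ, EM).prod 𝓘(ℝ, F →L[ℝ] F)) 𝓘(ℝ, F →L[ℝ] F') ∞
      (fun p : EndTotal F V => numer (inCoordinates (F × F) (fun x => V x × V x) (F' × F')
        (fun x => V' x × V' x) p₀.proj p.proj p₀.proj p.proj (A p.proj))
        (inCoordinates F V F V p₀.proj p.proj p₀.proj p.proj p.snd)) p₀ := by
  have hproj : ContMDiffAt (𝓘(ℝ, EM).prod 𝓘(ℝ, F →L[ℝ] F)) 𝓘(ℝ, EM) ∞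
      (fun p : EndTotal F V => p.proj) p₀ := contMDiffAt_proj _
  have h0 := (((contMDiffAt_hom_bundle _).1 (hA p₀.proj)).2).comp p₀ hproj
  have h1 := ((contMDiffAt_hom_bundle _).1 (contMDiffAt_id
    (I := 𝓘(ℝ, EM).prod 𝓘(ℝ, F →L[ℝ] F)) (x := p₀) (n := ∞))).2
  dsimp only [id] at h1
  have h2 : ContMDiffAt (𝓘(ℝ, EM).prod 𝓘(ℝ, F →L[ℝ] F)) 𝓘(ℝ, F →L[ℝ] F × F) ∞
      (fun p : EndTotal F V => (ContinuousLinearMap.id ℝ F).prod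
        (inCoordinates F V F V p₀.proj p.proj p₀.proj p.proj p.snd)) p₀ := by
    have h3 := (contMDiffAt_const (c := ContinuousLinearMap.inl ℝ F F) (n := ∞)
        (I := 𝓘(ℝ, EM).prod 𝓘(ℝ, F →L[ℝ] F)) (x := p₀) (I' := 𝓘(ℝ, F →L[ℝ] F × F))).add
      ((contMDiffAt_const (c := ContinuousLinearMap.inr ℝ F F)).clm_comp h1)
    refine h3.congr_of_eventuallyEq (Filter.Eventually.of_forall fun p => ?_)
    ext f <;> simp
  exact ⟨(contMDiffAt_const (c := ContinuousLinearMap.fst ℝ F' F')).clm_comp (h0.clm_comp h2),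
    (contMDiffAt_const (c := ContinuousLinearMap.snd ℝ F' F')).clm_comp (h0.clm_comp h2)⟩

variable [IsManifold 𝓘(ℝ, EM) ∞ M]
    [ContMDiffVectorBundle ∞ F V 𝓘(ℝ, EM)] [ContMDiffVectorBundle ∞ F' V' 𝓘(ℝ, EM)]
    {A : Π x : M, (V x × V x) →L[ℝ] (V' x × V' x)}

theorem eventually_mem_baseSet (p₀ : EndTotal F V) : ∀ᶠ p : EndTotal F V in 𝓝 p₀,
    p.proj ∈ (trivializationAt F V p₀.proj).baseSet ∧
      p.proj ∈ (trivializationAt F' V' p₀.proj).baseSet := by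
  have hc : ContinuousAt (fun p : EndTotal F V => p.proj) p₀ :=
    (FiberBundle.continuous_proj _ _).continuousAt
  filter_upwards [hc ((trivializationAt F V p₀.proj).open_baseSet.mem_nhds
      (FiberBundle.mem_baseSet_trivializationAt' p₀.proj)),
    hc ((trivializationAt F' V' p₀.proj).open_baseSet.mem_nhds
      (FiberBundle.mem_baseSet_trivializationAt' p₀.proj))] with p h h' using ⟨h, h'⟩

theorem contMDiffAt_mobiusMap
    (hA : ContMDiff 𝓘(ℝ, EM) (𝓘(ℝ, EM).prod 𝓘(ℝ, (F × F) →L[ℝ] (F' × F'))) ∞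
      (fun x => TotalSpace.mk' ((F × F) →L[ℝ] (F' × F'))
        (E := fun x => (V x × V x) →L[ℝ] (V' x × V' x)) x (A x)))
    (p₀ : EndTotal F V) (hp : (denom (A p₀.proj) p₀.snd).IsInvertible) :
    ContMDiffAt (𝓘(ℝ, EM).prod 𝓘(ℝ, F →L[ℝ] F)) (𝓘(ℝ, EM).prod 𝓘(ℝ, F' →L[ℝ] F')) ∞
      (mobiusMap F F' A) p₀ := by
  refine (contMDiffAt_hom_bundle (mobiusMap F F' A)).2 ⟨contMDiffAt_proj _, ?_⟩
  obtain ⟨hd, hn⟩ := contMDiffAt_denom_numer_inCoordinates hA p₀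
  have hx := FiberBundle.mem_baseSet_trivializationAt F V p₀.proj
  have hx' := FiberBundle.mem_baseSet_trivializationAt F' V' p₀.proj
  have hi := (isInvertible_inCoordinates hx hx' _).2 hp
  rw [denom_inCoordinates hx hx' (A p₀.proj) p₀.snd] at hi
  have h1 := hn.clm_comp ((hi.contDiffAt_map_inverse (n := ∞)).contMDiffAt.comp p₀ hd)
  refine h1.congr_of_eventuallyEq ?_
  filter_upwards [eventually_mem_baseSet (F := F) (F' := F') (V := V) (V' := V') p₀] with p hp
  exact mobius_inCoordinates hp.1 hp.2 _ _

theorem isOpen_isInvertible_denom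
    (hA : ContMDiff 𝓘(ℝ, EM) (𝓘(ℝ, EM).prod 𝓘(ℝ, (F × F) →L[ℝ] (F' × F'))) ∞
      (fun x => TotalSpace.mk' ((F × F) →L[ℝ] (F' × F'))
        (E := fun x => (V x × V x) →L[ℝ] (V' x × V' x)) x (A x))) :
    IsOpen {p : EndTotal F V | (denom (A p.proj) p.snd).IsInvertible} := by
  rw [isOpen_iff_mem_nhds]
  intro p₀ hp
  have hx := FiberBundle.mem_baseSet_trivializationAt F V p₀.proj
  have hx' := FiberBundle.mem_baseSet_trivializationAt F' V' p₀.proj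
  have hi := (isInvertible_inCoordinates hx hx' _).2 hp
  rw [denom_inCoordinates hx hx'] at hi
  obtain ⟨e, he⟩ := hi
  have h1 := (contMDiffAt_denom_numer_inCoordinates hA p₀).1.continuousAt
  have h2 := e.nhds
  rw [he] at h2
  filter_upwards [h1 h2, eventually_mem_baseSet (F := F) (F' := F') (V := V) (V' := V') p₀]
    with p hp' hb
  rw [Set.mem_preimage, ← denom_inCoordinates hb.1 hb.2] at hp'
  exact (isInvertible_inCoordinates hb.1 hb.2 _).1 hp'

end Smooth

section Connection

variable {EM : Type*} [NormedAddCommGroup EM] [NormedSpace ℝ EM]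
  {M : Type*} [TopologicalSpace M] [ChartedSpace EM M] [IsManifold 𝓘(ℝ, EM) ∞ M]
  {F : Type*} [NormedAddCommGroup F] [NormedSpace ℝ F] [FiniteDimensional ℝ F] {V : M → Type*}
  [TopologicalSpace (TotalSpace F V)] [∀ x, AddCommGroup (V x)] [∀ x, Module ℝ (V x)]
  [∀ x, TopologicalSpace (V x)] [∀ x, IsTopologicalAddGroup (V x)]
  [∀ x, ContinuousSMul ℝ (V x)] [FiberBundle F V] [VectorBundle ℝ F V]
  [ContMDiffVectorBundle ∞ F V 𝓘(ℝ, EM)]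

/-! ### The derivative of a section of the endomorphism bundle -/

/-- The operation `∇_v (T s) - T (∇_v s)` is tensorial in `s`; it gives the endomorphism `D = ∇_v T`. -/
theorem exists_covariantDerivative_end (cov : CovariantDerivative 𝓘(ℝ, EM) F V)
    {T : Π y, V y →L[ℝ] V y} {x : M}
    (dT : MDifferentiableAt 𝓘(ℝ, EM) (𝓘(ℝ, EM).prod 𝓘(ℝ, F →L[ℝ] F))
      (fun x => TotalSpace.mk' (F →L[ℝ] F) x (T x)) x) (v : TangentSpace 𝓘(ℝ, EM) x) :
    ∃ D : V x →L[ℝ] V x, ∀ s : Π y, V y,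
      MDifferentiableAt 𝓘(ℝ, EM) (𝓘(ℝ, EM).prod 𝓘(ℝ, F)) (fun y => TotalSpace.mk' F y (s y)) x →
      cov (fun y => T y (s y)) x v = T x (cov s x v) + D (s x) := by
  have hten : TensorialAt 𝓘(ℝ, EM) F
      (fun s => cov (fun y => T y (s y)) x v - T x (cov s x v)) x := by
    constructor
    · intro f s hf hs
      have h1 : (fun y => T y ((f • s) y)) = f • (fun y => T y (s y)) := by
        ext y; simp
      rw [h1, cov.isCovariantDerivativeOnUniv.leibniz (dT.clm_bundle_apply hs) hf,
        cov.isCovariantDerivativeOnUniv.leibniz hs hf]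
      simp [smul_sub]
    · intro s t hs ht
      have h1 : (fun y => T y ((s + t) y)) = (fun y => T y (s y)) + (fun y => T y (t y)) := by
        ext y; simp
      rw [h1, cov.isCovariantDerivativeOnUniv.add (dT.clm_bundle_apply hs)
        (dT.clm_bundle_apply ht), cov.isCovariantDerivativeOnUniv.add hs ht]
      simp
      abel
  refine ⟨hten.mkHom, fun s hs => ?_⟩
  rw [TensorialAt.mkHom_apply hten hs]
  abel

/-- A tangent vector `v ≠ 0` is detected by a function that vanishes at its base point. -/
theorem exists_function_with_derivative {x : M} {v : TangentSpace 𝓘(ℝ, EM) x} (hv : v ≠ 0) :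
    ∃ g : M → ℝ, g x = 0 ∧ MDifferentiableAt 𝓘(ℝ, EM) 𝓘(ℝ, ℝ) g x ∧
      mvfderiv 𝓘(ℝ, EM) g x v = 1 := by
  have hv' : (id v : EM) ≠ 0 := hv
  obtain ⟨l, hl⟩ := SeparatingDual.exists_eq_one (R := ℝ) hv'
  have hd := mdifferentiableAt_extChartAt (I := 𝓘(ℝ, EM)) (mem_chart_source EM x)
  have h1 := (l.hasMFDerivAt (x := _)).comp x hd.hasMFDerivAt
  rw [mfderiv_extChartAt_self] at h1
  have h2 := h1.sub (hasMFDerivAt_const (I := 𝓘(ℝ, EM)) (I' := 𝓘(ℝ, ℝ))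
    (l (extChartAt 𝓘(ℝ, EM) x x)) x)
  refine ⟨_, ?_, h2.mdifferentiableAt, ?_⟩
  · simp
  · refine (congrArg (fun T : EM →L[ℝ] ℝ => T v) h2.mfderiv).trans ?_
    exact (sub_zero (l v)).trans hl

theorem verticalVector_add (p : EndTotal F V) (B C : V p.proj →L[ℝ] V p.proj) :
    verticalVector (EM := EM) p (B + C) = verticalVector p B + verticalVector p C := by
  refine (vertical_apply p _).trans (Eq.trans ?_ (congrArg₂ (fun a b : EM × (F →L[ℝ] F) => a + b)
    (vertical_apply p B) (vertical_apply p C)).symm)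
  exact Prod.ext (add_zero 0).symm (map_add _ B C)

/-- The velocity of a section `T` of `End E` in the direction `v` has the vertical part `∇_v T`. -/
theorem mfderiv_section_eq (cov : CovariantDerivative 𝓘(ℝ, EM) F V)
    {T : Π y, V y →L[ℝ] V y} {x : M}
    (dT : MDifferentiableAt 𝓘(ℝ, EM) (𝓘(ℝ, EM).prod 𝓘(ℝ, F →L[ℝ] F))
      (fun x => TotalSpace.mk' (F →L[ℝ] F) x (T x)) x) (v : TangentSpace 𝓘(ℝ, EM) x)
    {D : V x →L[ℝ] V x} (hD : ∀ s : Π y, V y,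
      MDifferentiableAt 𝓘(ℝ, EM) (𝓘(ℝ, EM).prod 𝓘(ℝ, F)) (fun y => TotalSpace.mk' F y (s y)) x →
      cov (fun y => T y (s y)) x v = T x (cov s x v) + D (s x)) :
    ∃ h, IsHorizontalLift cov (TotalSpace.mk' (F →L[ℝ] F) x (T x)) v h ∧
      mfderiv 𝓘(ℝ, EM) (𝓘(ℝ, EM).prod 𝓘(ℝ, F →L[ℝ] F))
        (fun x => TotalSpace.mk' (F →L[ℝ] F) x (T x)) x v =
      verticalVector (TotalSpace.mk' (F →L[ℝ] F) x (T x)) D + h := by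
  by_cases hv : v = 0
  -- No function has a nonzero derivative in the direction `0`, but here `D = 0`.
  · have hD0 : D = 0 := by
      ext w
      have := hD _ (FiberBundle.mdifferentiableAt_extend 𝓘(ℝ, EM) F w)
      simpa [hv] using this.symm
    refine ⟨_, ⟨T, rfl, dT, fun s hs => ?_, rfl⟩, ?_⟩
    · rw [hD s hs, hD0]
      simp
    · have h0 : verticalVector (EM := EM) (TotalSpace.mk' (F →L[ℝ] F) x (T x)) D = 0 := by
        refine (vertical_apply _ _).trans ?_
        simp only [hD0, map_zero]
        rfl
      rw [h0, zero_add]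
  -- With `g x = 0` and `dg v = 1`, subtracting `g • S₁` from `T` leaves the value at `x` unchanged and
  -- makes the section parallel in the direction `v`.
  let S₁ : Π y, V y →L[ℝ] V y := FiberBundle.extend (F →L[ℝ] F) (E := fun x => V x →L[ℝ] V x) D
  have hS₁ : S₁ x = D := FiberBundle.extend_apply_self (F →L[ℝ] F) (E := fun x => V x →L[ℝ] V x) D
  have dS₁ : MDifferentiableAt 𝓘(ℝ, EM) (𝓘(ℝ, EM).prod 𝓘(ℝ, F →L[ℝ] F))
      (fun x => TotalSpace.mk' (F →L[ℝ] F) x (S₁ x)) x :=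
    FiberBundle.mdifferentiableAt_extend 𝓘(ℝ, EM) (F →L[ℝ] F) (V := fun x => V x →L[ℝ] V x) D
  obtain ⟨g, hg0, dg, hg1⟩ := exists_function_with_derivative hv
  have dg₁ := dg.smul_section dS₁
  have dS : MDifferentiableAt 𝓘(ℝ, EM) (𝓘(ℝ, EM).prod 𝓘(ℝ, F →L[ℝ] F))
      (fun x => TotalSpace.mk' (F →L[ℝ] F) x ((T - g • S₁) x)) x :=
    mdifferentiableAt_sub_section dT dg₁
  have hSx : (T - g • S₁) x = T x := by simp [hg0]
  refine ⟨_, ⟨T - g • S₁, hSx, dS, fun s hs => ?_, rfl⟩, ?_⟩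
  · have h1 : (fun y => T y (s y)) =
        (fun y => (T - g • S₁) y (s y)) + g • (fun y => S₁ y (s y)) := by
      ext y; simp
    have h2 := congrArg (fun L : EM →L[ℝ] V x => L v) (cov.isCovariantDerivativeOnUniv.add
      (dS.clm_bundle_apply hs) (dg.smul_section (dS₁.clm_bundle_apply hs)))
    have h3 := congrArg (fun L : EM →L[ℝ] V x => L v)
      (cov.isCovariantDerivativeOnUniv.leibniz (dS₁.clm_bundle_apply hs) dg)
    have h5 : cov (fun y => T y (s y)) x v = cov (fun y => (T - g • S₁) y (s y)) x v
        + cov (g • (fun y => S₁ y (s y))) x v := by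
      rw [h1]; exact h2
    have h6 : cov (g • (fun y => S₁ y (s y))) x v = D (s x) := by
      refine h3.trans ?_
      rw [hg0, hS₁]
      simp only [zero_smul, zero_add]
      exact (congrArg (fun r : ℝ => r • D (s x)) hg1).trans (one_smul ℝ (D (s x)))
    rw [hD s hs, h6] at h5
    rw [hSx]
    exact (add_right_cancel h5).symm
  · set e := trivializationAt (F →L[ℝ] F) (fun x => V x →L[ℝ] V x) x with he
    have hx : x ∈ e.baseSet := FiberBundle.mem_baseSet_trivializationAt' x
    have hcT := (mdifferentiableAt_section _ _).1 dT
    have hcS := (mdifferentiableAt_section _ _).1 dS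
    have hc₁ := (mdifferentiableAt_section _ _).1 dS₁
    rw [← he] at hcT hcS hc₁
    have hev : (fun y => (e (TotalSpace.mk' (F →L[ℝ] F) y (T y))).2) =ᶠ[𝓝 x]
        (fun y => (e (TotalSpace.mk' (F →L[ℝ] F) y ((T - g • S₁) y))).2) +
          g • (fun y => (e (TotalSpace.mk' (F →L[ℝ] F) y (S₁ y))).2) := by
      filter_upwards [e.open_baseSet.mem_nhds hx] with y hy
      have h1 := (e.linear ℝ hy).map_smul (g y) (S₁ y)
      have h2 := (e.linear ℝ hy).map_add ((T - g • S₁) y) (g y • S₁ y)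
      have h3 : (T - g • S₁) y + g y • S₁ y = T y := by simp
      rw [h1, h3] at h2
      exact h2
    have h4 : mvfderiv 𝓘(ℝ, EM) (fun y => (e (TotalSpace.mk' (F →L[ℝ] F) y (T y))).2) x v =
        mvfderiv 𝓘(ℝ, EM) (fun y => (e (TotalSpace.mk' (F →L[ℝ] F) y ((T - g • S₁) y))).2) x v +
        (e (TotalSpace.mk' (F →L[ℝ] F) x D)).2 := by
      have h5 : mvfderiv 𝓘(ℝ, EM) (fun y => (e (TotalSpace.mk' (F →L[ℝ] F) y (T y))).2) x =
          mvfderiv 𝓘(ℝ, EM) ((fun y => (e (TotalSpace.mk' (F →L[ℝ] F) y ((T - g • S₁) y))).2) +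
          g • (fun y => (e (TotalSpace.mk' (F →L[ℝ] F) y (S₁ y))).2)) x := by
        ext1 w
        exact congrArg (fun T : EM →L[ℝ] (F →L[ℝ] F) => T w) hev.mfderiv_eq
      rw [h5, mvfderiv_add hcS (dg.smul hc₁)]
      refine congrArg (fun z : F →L[ℝ] F => mvfderiv 𝓘(ℝ, EM)
        (fun y => (e (TotalSpace.mk' (F →L[ℝ] F) y ((T - g • S₁) y))).2) x v + z) ?_
      refine (congrArg (fun T : EM →L[ℝ] (F →L[ℝ] F) => T v) (mvfderiv_smul dg hc₁)).trans ?_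
      change g x • (mvfderiv 𝓘(ℝ, EM) (fun y => (e (TotalSpace.mk' (F →L[ℝ] F) y (S₁ y))).2) x v :
        F →L[ℝ] F) + (mvfderiv 𝓘(ℝ, EM) g x v : ℝ) •
          (e (TotalSpace.mk' (F →L[ℝ] F) x (S₁ x))).2 = _
      rw [hg0, zero_smul, zero_add, hS₁]
      exact (congrArg (fun r : ℝ => r • (e (TotalSpace.mk' (F →L[ℝ] F) x D)).2) hg1).trans
        (one_smul ℝ _)
    refine Prod.ext ?_ ?_
    · refine (section_fst T x dT v).trans (Eq.trans ?_ (congrArg (fun q : EM × (F →L[ℝ] F) => q.1 +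
        (mfderiv 𝓘(ℝ, EM) (𝓘(ℝ, EM).prod 𝓘(ℝ, F →L[ℝ] F))
          (fun x => TotalSpace.mk' (F →L[ℝ] F) x ((T - g • S₁) x)) x v : EM × (F →L[ℝ] F)).1)
        (vertical_apply _ _)).symm)
      rw [section_fst _ x dS v]
      exact (zero_add _).symm
    · refine (congrArg Prod.snd (mfderiv_totalSpace_apply _ _ dT v)).trans (Eq.trans ?_
        (congrArg₂ (fun q r : EM × (F →L[ℝ] F) => q.2 + r.2)
        (vertical_apply _ _) (mfderiv_totalSpace_apply _ _ dS v)).symm)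
      exact h4.trans (add_comm _ _)

/-! ### Sections of the complexification -/

theorem mdifferentiableAt_prod_section {s : Π x, V x × V x} {x : M} :
    MDifferentiableAt 𝓘(ℝ, EM) (𝓘(ℝ, EM).prod 𝓘(ℝ, F × F))
      (fun y => TotalSpace.mk' (F × F) (E := fun y => V y × V y) y (s y)) x ↔
    MDifferentiableAt 𝓘(ℝ, EM) (𝓘(ℝ, EM).prod 𝓘(ℝ, F))
      (fun y => TotalSpace.mk' F y (s y).1) x ∧
    MDifferentiableAt 𝓘(ℝ, EM) (𝓘(ℝ, EM).prod 𝓘(ℝ, F))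
      (fun y => TotalSpace.mk' F y (s y).2) x := by
  rw [mdifferentiableAt_section, mdifferentiableAt_section, mdifferentiableAt_section]
  constructor
  · intro h
    exact ⟨(ContinuousLinearMap.fst ℝ F F).mdifferentiableAt.comp x h,
      (ContinuousLinearMap.snd ℝ F F).mdifferentiableAt.comp x h⟩
  · exact fun h => h.1.prodMk_space h.2

theorem covC_add (cov : CovariantDerivative 𝓘(ℝ, EM) F V) {s t : Π x, V x × V x} {x : M}
    (hs : MDifferentiableAt 𝓘(ℝ, EM) (𝓘(ℝ, EM).prod 𝓘(ℝ, F × F))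
      (fun y => TotalSpace.mk' (F × F) (E := fun y => V y × V y) y (s y)) x)
    (ht : MDifferentiableAt 𝓘(ℝ, EM) (𝓘(ℝ, EM).prod 𝓘(ℝ, F × F))
      (fun y => TotalSpace.mk' (F × F) (E := fun y => V y × V y) y (t y)) x)
    (v : TangentSpace 𝓘(ℝ, EM) x) :
    covC cov (s + t) x v = covC cov s x v + covC cov t x v := by
  rw [mdifferentiableAt_prod_section] at hs ht
  have h1 := congrArg (fun L : EM →L[ℝ] V x => L v)
    (cov.isCovariantDerivativeOnUniv.add hs.1 ht.1)
  have h2 := congrArg (fun L : EM →L[ℝ] V x => L v)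
    (cov.isCovariantDerivativeOnUniv.add hs.2 ht.2)
  exact Prod.ext h1 h2

theorem covC_smul (cov : CovariantDerivative 𝓘(ℝ, EM) F V) {f : M → ℝ} {s : Π x, V x × V x} {x : M}
    (hf : MDifferentiableAt 𝓘(ℝ, EM) 𝓘(ℝ, ℝ) f x)
    (hs : MDifferentiableAt 𝓘(ℝ, EM) (𝓘(ℝ, EM).prod 𝓘(ℝ, F × F))
      (fun y => TotalSpace.mk' (F × F) (E := fun y => V y × V y) y (s y)) x)
    (v : TangentSpace 𝓘(ℝ, EM) x) :
    covC cov (f • s) x v = f x • covC cov s x v + mvfderiv 𝓘(ℝ, EM) f x v • s x := by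
  rw [mdifferentiableAt_prod_section] at hs
  have h1 := congrArg (fun L : EM →L[ℝ] V x => L v)
    (cov.isCovariantDerivativeOnUniv.leibniz hs.1 hf)
  have h2 := congrArg (fun L : EM →L[ℝ] V x => L v)
    (cov.isCovariantDerivativeOnUniv.leibniz hs.2 hf)
  exact Prod.ext h1 h2

variable {F' : Type*} [NormedAddCommGroup F'] [NormedSpace ℝ F'] [FiniteDimensional ℝ F']
  {V' : M → Type*} [TopologicalSpace (TotalSpace F' V')] [∀ x, AddCommGroup (V' x)]
  [∀ x, Module ℝ (V' x)] [∀ x, TopologicalSpace (V' x)] [∀ x, IsTopologicalAddGroup (V' x)]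
  [∀ x, ContinuousSMul ℝ (V' x)] [FiberBundle F' V'] [VectorBundle ℝ F' V']
  [ContMDiffVectorBundle ∞ F' V' 𝓘(ℝ, EM)]

/-- The covariant derivative `(∇_v A) s = ∇'_v (A s) - A (∇_v s)` of a bundle map `A` of
complexifications, applied to a section `s`. -/
def covHom (cov : CovariantDerivative 𝓘(ℝ, EM) F V) (cov' : CovariantDerivative 𝓘(ℝ, EM) F' V')
    (A : Π x : M, (V x × V x) →L[ℝ] (V' x × V' x)) (s : Π x, V x × V x) (x : M)
    (v : TangentSpace 𝓘(ℝ, EM) x) : V' x × V' x :=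
  covC cov' (fun y => A y (s y)) x v - A x (covC cov s x v)

theorem tensorialAt_covHom (cov : CovariantDerivative 𝓘(ℝ, EM) F V)
    (cov' : CovariantDerivative 𝓘(ℝ, EM) F' V')
    {A : Π x : M, (V x × V x) →L[ℝ] (V' x × V' x)} {x : M}
    (hA : MDifferentiableAt 𝓘(ℝ, EM) (𝓘(ℝ, EM).prod 𝓘(ℝ, (F × F) →L[ℝ] (F' × F')))
      (fun x => TotalSpace.mk' ((F × F) →L[ℝ] (F' × F'))
        (E := fun x => (V x × V x) →L[ℝ] (V' x × V' x)) x (A x)) x)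
    (v : TangentSpace 𝓘(ℝ, EM) x) :
    TensorialAt 𝓘(ℝ, EM) (F × F) (V := fun x => V x × V x)
      (fun s => covHom cov cov' A s x v) x := by
  constructor
  · intro f s hf hs
    have h1 : (fun y => A y ((f • s) y)) = f • (fun y => A y (s y)) := by
      ext1 y; simp
    simp only [covHom]
    rw [h1, covC_smul cov' hf (hA.clm_bundle_apply hs), covC_smul cov hf hs]
    simp [smul_sub]
  · intro s t hs ht
    have h1 : (fun y => A y ((s + t) y)) = (fun y => A y (s y)) + (fun y => A y (t y)) := by
      ext1 y; simp
    simp only [covHom]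
    rw [h1, covC_add cov' (hA.clm_bundle_apply hs) (hA.clm_bundle_apply ht), covC_add cov hs ht]
    simp only [map_add]
    abel

/-- A holomorphic bundle map satisfies `∇_{Iv} A = i ∇_v A`. -/
theorem IsHolomorphicBundleIso.covHom_apply {cov : CovariantDerivative 𝓘(ℝ, EM) F V}
    {cov' : CovariantDerivative 𝓘(ℝ, EM) F' V'}
    {I : Π x : M, TangentSpace 𝓘(ℝ, EM) x →L[ℝ] TangentSpace 𝓘(ℝ, EM) x}
    {A : Π x : M, (V x × V x) →L[ℝ] (V' x × V' x)} (hA : IsHolomorphicBundleIso cov cov' I A)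
    {s : Π x, V x × V x} {x : M}
    (hs : MDifferentiableAt 𝓘(ℝ, EM) (𝓘(ℝ, EM).prod 𝓘(ℝ, F × F))
      (fun y => TotalSpace.mk' (F × F) (E := fun y => V y × V y) y (s y)) x)
    (v : TangentSpace 𝓘(ℝ, EM) x) :
    covHom cov cov' A s x (I x v) = mulI (covHom cov cov' A s x v) := by
  have h := hA.intertwines s x hs v
  simp only [dbar, map_smul, map_add, hA.complexLinear] at h
  have h1 := smul_right_injective _ (by norm_num : (1 / 2 : ℝ) ≠ 0) h
  simp only [covHom]
  generalize covC cov' (fun y => A y (s y)) x v = a at *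
  generalize covC cov' (fun y => A y (s y)) x (I x v) = b at *
  generalize A x (covC cov s x v) = c at *
  generalize A x (covC cov s x (I x v)) = d at *
  obtain ⟨a1, a2⟩ := a
  obtain ⟨b1, b2⟩ := b
  obtain ⟨c1, c2⟩ := c
  obtain ⟨d1, d2⟩ := d
  simp only [mulI, Prod.mk_add_mk, Prod.mk.injEq, Prod.mk_sub_mk] at h1 ⊢
  obtain ⟨h1, h2⟩ := h1
  constructor
  · rw [sub_eq_iff_eq_add, eq_sub_of_add_eq h2]
    abel
  · rw [← sub_eq_add_neg, ← sub_eq_add_neg, sub_eq_iff_eq_add] at h1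
    rw [h1]
    abel

end Connection

section Differential

variable {EM : Type*} [NormedAddCommGroup EM] [NormedSpace ℝ EM]
  {M : Type*} [TopologicalSpace M] [ChartedSpace EM M] [IsManifold 𝓘(ℝ, EM) ∞ M]
  {F : Type*} [NormedAddCommGroup F] [NormedSpace ℝ F] [FiniteDimensional ℝ F] {V : M → Type*}
  [TopologicalSpace (TotalSpace F V)] [∀ x, AddCommGroup (V x)] [∀ x, Module ℝ (V x)]
  [∀ x, TopologicalSpace (V x)] [∀ x, IsTopologicalAddGroup (V x)]
  [∀ x, ContinuousSMul ℝ (V x)] [FiberBundle F V] [VectorBundle ℝ F V]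
  [ContMDiffVectorBundle ∞ F V 𝓘(ℝ, EM)]
  {F' : Type*} [NormedAddCommGroup F'] [NormedSpace ℝ F'] [FiniteDimensional ℝ F']
  {V' : M → Type*} [TopologicalSpace (TotalSpace F' V')] [∀ x, AddCommGroup (V' x)]
  [∀ x, Module ℝ (V' x)] [∀ x, TopologicalSpace (V' x)] [∀ x, IsTopologicalAddGroup (V' x)]
  [∀ x, ContinuousSMul ℝ (V' x)] [FiberBundle F' V'] [VectorBundle ℝ F' V']
  [ContMDiffVectorBundle ∞ F' V' 𝓘(ℝ, EM)]
  {cov : CovariantDerivative 𝓘(ℝ, EM) F V} {cov' : CovariantDerivative 𝓘(ℝ, EM) F' V'}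
  {I : Π x : M, TangentSpace 𝓘(ℝ, EM) x →L[ℝ] TangentSpace 𝓘(ℝ, EM) x}
  {A : Π x : M, (V x × V x) →L[ℝ] (V' x × V' x)}

/-! ### The differential of the fractional linear map -/

/-- Comparison of differentials at equal base points, whose tangent spaces are all the model space. -/
theorem mfderiv_eq_of_eq {f : EndTotal F V → EndTotal F' V'} {p q : EndTotal F V} (h : q = p)
    (w : EM × (F →L[ℝ] F)) :
    (mfderiv (𝓘(ℝ, EM).prod 𝓘(ℝ, F →L[ℝ] F)) (𝓘(ℝ, EM).prod 𝓘(ℝ, F' →L[ℝ] F')) f q w :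
      EM × (F' →L[ℝ] F')) =
    mfderiv (𝓘(ℝ, EM).prod 𝓘(ℝ, F →L[ℝ] F)) (𝓘(ℝ, EM).prod 𝓘(ℝ, F' →L[ℝ] F')) f p w := by
  rw [h]

/-- The vertical vector `B` is mapped to the vertical vector `C` obtained by differentiating
`J' ∘ (P - Q J) = Q + P J`. -/
theorem mfderiv_mobiusMap_verticalVector
    (hA : ContMDiff 𝓘(ℝ, EM) (𝓘(ℝ, EM).prod 𝓘(ℝ, (F × F) →L[ℝ] (F' × F'))) ∞
      (fun x => TotalSpace.mk' ((F × F) →L[ℝ] (F' × F'))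
        (E := fun x => (V x × V x) →L[ℝ] (V' x × V' x)) x (A x)))
    (p : EndTotal F V) (hp : (denom (A p.proj) p.snd).IsInvertible)
    (B : V p.proj →L[ℝ] V p.proj) :
    ∃ C : V' p.proj →L[ℝ] V' p.proj,
      mfderiv (𝓘(ℝ, EM).prod 𝓘(ℝ, F →L[ℝ] F)) (𝓘(ℝ, EM).prod 𝓘(ℝ, F' →L[ℝ] F'))
        (mobiusMap F F' A) p (verticalVector p B) = verticalVector (mobiusMap F F' A p) C ∧
      ∀ u, C (denom (A p.proj) p.snd u) =
        (A p.proj (0, B u)).2 - mobius (A p.proj) p.snd (A p.proj (0, B u)).1 := by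
  obtain ⟨x, J⟩ := p
  dsimp only at hp B ⊢
  -- The curve with velocity `B`; its image lies in the fibre over `x`.
  set c : ℝ → EndTotal F V := fun t => TotalSpace.mk' (F →L[ℝ] F)
    (E := fun x => V x →L[ℝ] V x) x (J + t • B) with hc
  have hc0 : c 0 = ⟨x, J⟩ := by simp [hc]
  have dc : MDifferentiableAt 𝓘(ℝ, ℝ) (𝓘(ℝ, EM).prod 𝓘(ℝ, F →L[ℝ] F)) c 0 := by
    rw [mdifferentiableAt_totalSpace]
    refine ⟨mdifferentiableAt_const, ?_⟩
    set L := (trivializationAt (F →L[ℝ] F) (fun x => V x →L[ℝ] V x) x).continuousLinearEquivAt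
      ℝ x (FiberBundle.mem_baseSet_trivializationAt' x)
    have hL : (fun t : ℝ => (trivializationAt (F →L[ℝ] F) (fun x => V x →L[ℝ] V x) (c 0).proj
        (c t)).2) = fun t => L J + t • L B := by
      ext1 t
      rw [← map_smul, ← map_add]
      rfl
    rw [hL]
    exact (((ContinuousLinearMap.id ℝ ℝ).smulRight (L B)).hasFDerivAt.const_add
      (L J)).differentiableAt.mdifferentiableAt
  have dG : MDifferentiableAt (𝓘(ℝ, EM).prod 𝓘(ℝ, F →L[ℝ] F)) (𝓘(ℝ, EM).prod 𝓘(ℝ, F' →L[ℝ] F'))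
      (mobiusMap F F' A) (c 0) := by
    rw [hc0]
    exact (contMDiffAt_mobiusMap hA _ hp).mdifferentiableAt (by simp)
  have dGc := dG.comp 0 dc
  set L := (trivializationAt (F' →L[ℝ] F') (fun x => V' x →L[ℝ] V' x) x).continuousLinearEquivAt
      ℝ x (FiberBundle.mem_baseSet_trivializationAt' x)
  set e := (trivializationAt F' V' x).continuousLinearEquivAt ℝ x
    (FiberBundle.mem_baseSet_trivializationAt' x)
  have hL : ∀ (φ : V' x →L[ℝ] V' x) (w : V' x), L φ (e w) = e (φ w) := by
    intro φ w
    have hx' := FiberBundle.mem_baseSet_trivializationAt F' V' x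
    have h1 : L φ = ContinuousLinearMap.inCoordinates F' V' F' V' x x x x φ := rfl
    rw [h1, ContinuousLinearMap.inCoordinates_eq hx' hx']
    change e (φ (e.symm (e w))) = _
    rw [e.symm_apply_apply]
  have dγ : MDifferentiableAt 𝓘(ℝ, ℝ) 𝓘(ℝ, F' →L[ℝ] F') (fun t : ℝ => L (mobius (A x) (J + t • B))) 0 :=
    ((mdifferentiableAt_totalSpace _ _).1 dGc).2
  set Γ : F' →L[ℝ] F' := mfderiv 𝓘(ℝ, ℝ) 𝓘(ℝ, F' →L[ℝ] F')
    (fun t : ℝ => L (mobius (A x) (J + t • B))) 0 (1 : ℝ) with hΓ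
  have hγ : HasDerivAt (fun t : ℝ => L (mobius (A x) (J + t • B))) Γ 0 := by
    have h1 := (mdifferentiableAt_iff_differentiableAt.1 dγ).hasDerivAt
    rw [hΓ, mfderiv_eq_fderiv]
    exact h1
  refine ⟨L.symm Γ, ?_, fun u => ?_⟩
  · have h1 := congrArg (fun T : ℝ →L[ℝ] EM × (F' →L[ℝ] F') => T 1) (mfderiv_comp (0 : ℝ) dG dc)
    have h2 : (mfderiv 𝓘(ℝ, ℝ) (𝓘(ℝ, EM).prod 𝓘(ℝ, F' →L[ℝ] F')) (mobiusMap F F' A ∘ c) 0 (1 : ℝ) :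
        EM × (F' →L[ℝ] F')) = (0, Γ) := by
      refine (mfderiv_totalSpace_apply _ _ dGc (1 : ℝ)).trans (Prod.ext ?_ rfl)
      exact congrArg (fun T : ℝ →L[ℝ] EM => T 1)
        (mfderiv_const (I := 𝓘(ℝ, ℝ)) (I' := 𝓘(ℝ, EM)) (x := (0 : ℝ)) (c := x))
    refine ((mfderiv_eq_of_eq hc0 _).symm.trans (h1.symm.trans h2)).trans ?_
    refine ((vertical_apply (EM := EM) (mobiusMap F F' A ⟨x, J⟩) (L.symm Γ)).trans ?_).symm
    exact Prod.ext rfl (L.apply_symm_apply Γ)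
  -- Near `t = 0` the relation `mobius A (J + t B) ∘ denom A (J + t B) = numer A (J + t B)` holds, with
  -- denominator and numerator affine in `t`; it is differentiated in a trivialization.
  · have hden : ∀ t : ℝ, denom (A x) (J + t • B) u = denom (A x) J u + t • (A x (0, B u)).1 := by
      intro t
      have h1 : (u, (J + t • B) u) = (u, J u) + t • ((0 : V x), B u) := by simp
      have h2 := congrArg (fun z => (A x z).1) h1
      rw [map_add, map_smul] at h2
      exact h2
    have hnum : ∀ t : ℝ, numer (A x) (J + t • B) u = numer (A x) J u + t • (A x (0, B u)).2 := by
      intro t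
      have h1 : (u, (J + t • B) u) = (u, J u) + t • ((0 : V x), B u) := by simp
      have h2 := congrArg (fun z => (A x z).2) h1
      rw [map_add, map_smul] at h2
      exact h2
    have line : ∀ a b : F', HasDerivAt (fun t : ℝ => a + t • b) b 0 := fun a b => by
      simpa using ((hasDerivAt_id (0 : ℝ)).smul_const b).const_add a
    have h1 := hγ.clm_apply (line (e (denom (A x) J u)) (e (A x (0, B u)).1))
    have h2 := line (e (numer (A x) J u)) (e (A x (0, B u)).2)
    have hev : (fun t : ℝ => L (mobius (A x) (J + t • B))
        (e (denom (A x) J u) + t • e (A x (0, B u)).1)) =ᶠ[𝓝 0]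
        fun t => e (numer (A x) J u) + t • e (A x (0, B u)).2 := by
      have hopen := dc.continuousAt.preimage_mem_nhds
        ((isOpen_isInvertible_denom hA).mem_nhds (by rw [hc0]; exact hp))
      filter_upwards [hopen] with t ht
      rw [← map_smul, ← map_add, ← hden, hL, mobius_denom ht, hnum, map_add, map_smul]
    have h3 := h1.unique (h2.congr_of_eventuallyEq hev)
    simp only [zero_smul, add_zero, hL] at h3
    apply e.injective
    rw [← hL, L.apply_symm_apply, map_sub, ← h3]
    simp

/-- If `S` is parallel at `x` in the direction `v`, then the covariant derivative `D` of its image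
`T` under the fractional linear map is expressed by `∇_v A`. -/
theorem covariantDerivative_mobius
    (hA : ContMDiff 𝓘(ℝ, EM) (𝓘(ℝ, EM).prod 𝓘(ℝ, (F × F) →L[ℝ] (F' × F'))) ∞
      (fun x => TotalSpace.mk' ((F × F) →L[ℝ] (F' × F'))
        (E := fun x => (V x × V x) →L[ℝ] (V' x × V' x)) x (A x)))
    {S : Π y, V y →L[ℝ] V y} {x : M} (hp : (denom (A x) (S x)).IsInvertible)
    (dS : MDifferentiableAt 𝓘(ℝ, EM) (𝓘(ℝ, EM).prod 𝓘(ℝ, F →L[ℝ] F))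
      (fun x => TotalSpace.mk' (F →L[ℝ] F) x (S x)) x) {v : TangentSpace 𝓘(ℝ, EM) x}
    (hS : IsParallelAt cov S x v)
    (dT : MDifferentiableAt 𝓘(ℝ, EM) (𝓘(ℝ, EM).prod 𝓘(ℝ, F' →L[ℝ] F'))
      (fun y => TotalSpace.mk' (F' →L[ℝ] F') y (mobius (A y) (S y))) x)
    {D : V' x →L[ℝ] V' x} (hD : ∀ s : Π y, V' y,
      MDifferentiableAt 𝓘(ℝ, EM) (𝓘(ℝ, EM).prod 𝓘(ℝ, F')) (fun y => TotalSpace.mk' F' y (s y)) x →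
      cov' (fun y => mobius (A y) (S y) (s y)) x v =
        mobius (A x) (S x) (cov' s x v) + D (s x))
    {s : Π x, V x × V x} (hs : MDifferentiableAt 𝓘(ℝ, EM) (𝓘(ℝ, EM).prod 𝓘(ℝ, F × F))
      (fun y => TotalSpace.mk' (F × F) (E := fun y => V y × V y) y (s y)) x) (u : V x)
    (hsu : s x = (u, S x u)) :
    D (denom (A x) (S x) u) =
      (covHom cov cov' A s x v).2 - mobius (A x) (S x) (covHom cov cov' A s x v).1 := by
  have dA := (hA x).mdifferentiableAt (by simp)
  let u' : Π y, V y := FiberBundle.extend F u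
  have hu' : u' x = u := FiberBundle.extend_apply_self F u
  have du' : MDifferentiableAt 𝓘(ℝ, EM) (𝓘(ℝ, EM).prod 𝓘(ℝ, F))
      (fun y => TotalSpace.mk' F y (u' y)) x := FiberBundle.mdifferentiableAt_extend 𝓘(ℝ, EM) F u
  -- Both `s` and `s₀ = (u', S u')` have the value `(u, S x u)` at `x`, and `∇_v A` is tensorial. The
  -- components of `A s₀` are related by the image section, and `∇_v s₀` lies in the graph of `S x`.
  let s₀ : Π y, V y × V y := fun y => (u' y, S y (u' y))
  have ds₀ : MDifferentiableAt 𝓘(ℝ, EM) (𝓘(ℝ, EM).prod 𝓘(ℝ, F × F))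
      (fun y => TotalSpace.mk' (F × F) (E := fun y => V y × V y) y (s₀ y)) x :=
    mdifferentiableAt_prod_section.2 ⟨du', dS.clm_bundle_apply du'⟩
  have hss : covHom cov cov' A s x v = covHom cov cov' A s₀ x v :=
    (tensorialAt_covHom cov cov' dA v).pointwise hs ds₀ (by simp [hsu, s₀, hu'])
  obtain ⟨dn, dz⟩ := mdifferentiableAt_prod_section.1 (dA.clm_bundle_apply ds₀)
  have hev : ∀ᶠ y in 𝓝 x, (A y (s₀ y)).2 = mobius (A y) (S y) (A y (s₀ y)).1 := by
    have hopen := dS.continuousAt.preimage_mem_nhds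
      ((isOpen_isInvertible_denom hA).mem_nhds hp)
    filter_upwards [hopen] with y hy
    exact (mobius_denom hy _).symm
  have h1 : cov' (fun y => (A y (s₀ y)).2) x v =
      cov' (fun y => mobius (A y) (S y) (A y (s₀ y)).1) x v :=
    congrArg (fun L : EM →L[ℝ] V' x => L v)
      (cov'.isCovariantDerivativeOnUniv.congr_of_eventuallyEq dz (dT.clm_bundle_apply dn)
        Filter.univ_mem hev)
  rw [hD _ dn] at h1
  have h2 : covC cov s₀ x v = (cov u' x v, S x (cov u' x v)) := Prod.ext rfl (hS u' du')
  rw [hss, covHom, h2, apply_graph]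
  simp only [covC, Prod.fst_sub, Prod.snd_sub, h1, map_sub, mobius_denom hp]
  have h3 : (A x (s₀ x)).1 = denom (A x) (S x) u := by
    simp only [s₀, hu']
    rfl
  rw [h3]
  abel

/-- The image of the horizontal lift of `v` is the horizontal lift of `v` plus a vertical vector that
is expressed by `∇_v A`. -/
theorem mfderiv_mobiusMap_horizontalLift
    (hA : ContMDiff 𝓘(ℝ, EM) (𝓘(ℝ, EM).prod 𝓘(ℝ, (F × F) →L[ℝ] (F' × F'))) ∞
      (fun x => TotalSpace.mk' ((F × F) →L[ℝ] (F' × F'))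
        (E := fun x => (V x × V x) →L[ℝ] (V' x × V' x)) x (A x)))
    (p : EndTotal F V) (hp : (denom (A p.proj) p.snd).IsInvertible)
    {v : TangentSpace 𝓘(ℝ, EM) p.proj}
    {h : TangentSpace (𝓘(ℝ, EM).prod 𝓘(ℝ, F →L[ℝ] F)) p} (H : IsHorizontalLift cov p v h)
    (cov' : CovariantDerivative 𝓘(ℝ, EM) F' V') :
    ∃ (D : V' p.proj →L[ℝ] V' p.proj)
      (k : TangentSpace (𝓘(ℝ, EM).prod 𝓘(ℝ, F' →L[ℝ] F')) (mobiusMap F F' A p)),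
      IsHorizontalLift cov' (mobiusMap F F' A p) v k ∧
      mfderiv (𝓘(ℝ, EM).prod 𝓘(ℝ, F →L[ℝ] F)) (𝓘(ℝ, EM).prod 𝓘(ℝ, F' →L[ℝ] F'))
        (mobiusMap F F' A) p h = verticalVector (mobiusMap F F' A p) D + k ∧
      ∀ (s : Π x, V x × V x) (_ : MDifferentiableAt 𝓘(ℝ, EM) (𝓘(ℝ, EM).prod 𝓘(ℝ, F × F))
        (fun y => TotalSpace.mk' (F × F) (E := fun y => V y × V y) y (s y)) p.proj) (u : V p.proj),
        s p.proj = (u, p.snd u) → D (denom (A p.proj) p.snd u) =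
          (covHom cov cov' A s p.proj v).2 -
            mobius (A p.proj) p.snd (covHom cov cov' A s p.proj v).1 := by
  obtain ⟨S, hS, dS, pS, rfl⟩ := H
  obtain ⟨x, J⟩ := p
  dsimp only at hp v hS dS pS ⊢
  subst hS
  have dG : MDifferentiableAt (𝓘(ℝ, EM).prod 𝓘(ℝ, F →L[ℝ] F)) (𝓘(ℝ, EM).prod 𝓘(ℝ, F' →L[ℝ] F'))
      (mobiusMap F F' A) ⟨x, S x⟩ := (contMDiffAt_mobiusMap hA _ hp).mdifferentiableAt (by simp)
  have dT : MDifferentiableAt 𝓘(ℝ, EM) (𝓘(ℝ, EM).prod 𝓘(ℝ, F' →L[ℝ] F'))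
      (fun y => TotalSpace.mk' (F' →L[ℝ] F') y (mobius (A y) (S y))) x := dG.comp x dS
  obtain ⟨D, hD⟩ := exists_covariantDerivative_end cov' dT v
  obtain ⟨k, hk, hk'⟩ := mfderiv_section_eq cov' dT v hD
  refine ⟨D, k, hk, ?_, fun s hs u hsu => covariantDerivative_mobius hA hp dS pS dT hD hs u hsu⟩
  have h1 := congrArg (fun T : EM →L[ℝ] EM × (F' →L[ℝ] F') => T v) (mfderiv_comp x dG dS)
  exact h1.symm.trans hk'

/-- On complex structures the fractional linear map intertwines `𝒥^{(∇,I)}` and `𝒥^{(∇',I)}`. -/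
theorem mfderiv_mobiusMap_twistorJ (hA : IsHolomorphicBundleIso cov cov' I A)
    (p : EndTotal F V) (hJ : p ∈ twistorC F V) (hp : (denom (A p.proj) p.snd).IsInvertible)
    (X : TangentSpace (𝓘(ℝ, EM).prod 𝓘(ℝ, F →L[ℝ] F)) p) :
    mfderiv (𝓘(ℝ, EM).prod 𝓘(ℝ, F →L[ℝ] F)) (𝓘(ℝ, EM).prod 𝓘(ℝ, F' →L[ℝ] F'))
        (mobiusMap F F' A) p (twistorJ cov I p X) =
      twistorJ cov' I (mobiusMap F F' A p)
        (mfderiv (𝓘(ℝ, EM).prod 𝓘(ℝ, F →L[ℝ] F)) (𝓘(ℝ, EM).prod 𝓘(ℝ, F' →L[ℝ] F'))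
          (mobiusMap F F' A) p X) := by
  obtain ⟨v, B, h, h', H, H', hX, hY⟩ := twistorJ_spec cov I p X
  obtain ⟨C, hC, hC'⟩ := mfderiv_mobiusMap_verticalVector hA.smooth p hp B
  obtain ⟨C₁, hC₁, hC₁'⟩ := mfderiv_mobiusMap_verticalVector hA.smooth p hp (p.snd.comp B)
  obtain ⟨D, k, K, hD, hD'⟩ := mfderiv_mobiusMap_horizontalLift hA.smooth p hp H cov'
  obtain ⟨D₁, k₁, K₁, hD₁, hD₁'⟩ := mfderiv_mobiusMap_horizontalLift hA.smooth p hp H' cov'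
  refine (existsUnique_twistorJ cov' I (mobiusMap F F' A p) _).unique
    ⟨v, C + D, k, k₁, K, K₁, ?_, ?_⟩ (twistorJ_spec _ _ _ _)
  · rw [hX]
    refine ((mfderiv _ _ (mobiusMap F F' A) p).map_add _ _).trans ?_
    refine (congrArg₂ (fun a b : EM × (F' →L[ℝ] F') => a + b) hC hD).trans ?_
    exact (add_assoc _ _ _).symm.trans (congrArg (fun a : TangentSpace
      (𝓘(ℝ, EM).prod 𝓘(ℝ, F' →L[ℝ] F')) (mobiusMap F F' A p) => a + k)
      (verticalVector_add (EM := EM) (mobiusMap F F' A p) C D).symm)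
  have key : C₁ + D₁ = (mobius (A p.proj) p.snd).comp (C + D) := by
    ext w
    obtain ⟨u, rfl⟩ := hp.surjective w
    let s : Π y, V y × V y := FiberBundle.extend (F × F) (E := fun y => V y × V y)
      ((u, p.snd u) : V p.proj × V p.proj)
    have hs : s p.proj = (u, p.snd u) :=
      FiberBundle.extend_apply_self (F × F) (E := fun y => V y × V y) _
    have ds := FiberBundle.mdifferentiableAt_extend 𝓘(ℝ, EM) (F × F) (V := fun y => V y × V y)
      ((u, p.snd u) : V p.proj × V p.proj)
    have hsq : ∀ w, mobius (A p.proj) p.snd (mobius (A p.proj) p.snd w) = -w :=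
      mobius_sq (hA.complexLinear _) hp hJ
    -- `A (B u, J B u)` lies in the graph of `J'`, and `A (-B u, 0) = i A (0, B u)`.
    have h1 : A p.proj (0, p.snd (B u)) =
        (denom (A p.proj) p.snd (B u), numer (A p.proj) p.snd (B u)) +
          mulI (A p.proj (0, B u)) := by
      rw [← apply_graph, ← hA.complexLinear, ← map_add]
      simp [mulI]
    have h2 := hA.covHom_apply ds v
    simp only [add_apply, ContinuousLinearMap.comp_apply, map_add, hC', hC₁',
      hD' s ds u hs, hD₁' s ds u hs]
    rw [h1, h2]
    simp only [mulI, Prod.mk_add_mk, map_add, map_sub, map_neg, mobius_denom hp, hsq]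
    abel
  rw [hY]
  refine ((mfderiv _ _ (mobiusMap F F' A) p).map_add _ _).trans ?_
  refine (congrArg₂ (fun a b : EM × (F' →L[ℝ] F') => a + b) hC₁ hD₁).trans ?_
  refine (add_assoc _ _ _).symm.trans (congrArg (fun a : TangentSpace
      (𝓘(ℝ, EM).prod 𝓘(ℝ, F' →L[ℝ] F')) (mobiusMap F F' A p) => a + k₁) ?_)
  exact (verticalVector_add (EM := EM) (mobiusMap F F' A p) C₁ D₁).symm.trans
    (congrArg (verticalVector (EM := EM) (mobiusMap F F' A p)) key)

end Differential

section Biholomorphism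

variable {EM : Type*} [NormedAddCommGroup EM] [NormedSpace ℝ EM]
  {M : Type*} [TopologicalSpace M] [ChartedSpace EM M] [IsManifold 𝓘(ℝ, EM) ∞ M]
  {F : Type*} [NormedAddCommGroup F] [NormedSpace ℝ F] [FiniteDimensional ℝ F] {V : M → Type*}
  [TopologicalSpace (TotalSpace F V)] [∀ x, AddCommGroup (V x)] [∀ x, Module ℝ (V x)]
  [∀ x, TopologicalSpace (V x)] [∀ x, IsTopologicalAddGroup (V x)]
  [∀ x, ContinuousSMul ℝ (V x)] [FiberBundle F V] [VectorBundle ℝ F V]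
  [ContMDiffVectorBundle ∞ F V 𝓘(ℝ, EM)]
  {F' : Type*} [NormedAddCommGroup F'] [NormedSpace ℝ F'] [FiniteDimensional ℝ F']
  {V' : M → Type*} [TopologicalSpace (TotalSpace F' V')] [∀ x, AddCommGroup (V' x)]
  [∀ x, Module ℝ (V' x)] [∀ x, TopologicalSpace (V' x)] [∀ x, IsTopologicalAddGroup (V' x)]
  [∀ x, ContinuousSMul ℝ (V' x)] [FiberBundle F' V'] [VectorBundle ℝ F' V']
  [ContMDiffVectorBundle ∞ F' V' 𝓘(ℝ, EM)]
  {cov : CovariantDerivative 𝓘(ℝ, EM) F V} {cov' : CovariantDerivative 𝓘(ℝ, EM) F' V'}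
  {I : Π x : M, TangentSpace 𝓘(ℝ, EM) x →L[ℝ] TangentSpace 𝓘(ℝ, EM) x}
  {A : Π x : M, (V x × V x) →L[ℝ] (V' x × V' x)}

/-! ### The induced biholomorphism -/

theorem IsHolomorphicBundleIso.isInvertible (hA : IsHolomorphicBundleIso cov cov' I A) (x : M) :
    (A x).IsInvertible := by
  have : T2Space (V x) := FiberBundle.t2Space F V x
  have : FiniteDimensional ℝ (V x) := VectorBundle.finiteDimensional ℝ F V x
  have : T2Space (V' x) := FiberBundle.t2Space F' V' x
  have : FiniteDimensional ℝ (V' x) := VectorBundle.finiteDimensional ℝ F' V' x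
  exact isInvertible_of_bijective (hA.bijective x)

theorem IsHolomorphicBundleIso.isInvertible_denom (hA : IsHolomorphicBundleIso cov cov' I A)
    {x : M} {J : V x →L[ℝ] V x} (h : Function.Injective (denom (A x) J)) :
    (denom (A x) J).IsInvertible := by
  have : T2Space (V x) := FiberBundle.t2Space F V x
  have : FiniteDimensional ℝ (V x) := VectorBundle.finiteDimensional ℝ F V x
  have : T2Space (V' x) := FiberBundle.t2Space F' V' x
  have : FiniteDimensional ℝ (V' x) := VectorBundle.finiteDimensional ℝ F' V' x
  exact TwistorSpaces.isInvertible_denom (hA.bijective x) h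

/-- The inverse of an isomorphism of holomorphic bundles is one as well. -/
theorem IsHolomorphicBundleIso.inverse (hA : IsHolomorphicBundleIso cov cov' I A) :
    IsHolomorphicBundleIso cov' cov I (fun x => (A x).inverse) where
  smooth := contMDiff_inverse_section (V := fun x => V x × V x) (V' := fun x => V' x × V' x)
    hA.smooth hA.isInvertible
  complexLinear x u := by
    rw [(hA.isInvertible x).inverse_apply_eq, hA.complexLinear,
      (hA.isInvertible x).self_apply_inverse]
  bijective x := (hA.isInvertible x).inverse.bijective
  intertwines s x hs v := by
    have hB := contMDiff_inverse_section (V := fun x => V x × V x) (V' := fun x => V' x × V' x)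
      hA.smooth hA.isInvertible
    have h1 := hA.intertwines (fun y => (A y).inverse (s y)) x
      (((hB x).mdifferentiableAt (by simp)).clm_bundle_apply hs) v
    simp only [(hA.isInvertible _).self_apply_inverse] at h1
    rw [h1, (hA.isInvertible x).inverse_apply_self]

theorem isHolomorphic_mobiusMap (hA : IsHolomorphicBundleIso cov cov' I A)
    {S : Set (EndTotal F V)} {S' : Set (EndTotal F' V')} (hS : S ⊆ twistorC F V)
    (hinv : ∀ p ∈ S, (denom (A p.proj) p.snd).IsInvertible) {f : S → S'}
    (hf : ∀ p : S, (f p : EndTotal F' V') = mobiusMap F F' A p) :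
    IsHolomorphic (𝓘(ℝ, EM).prod 𝓘(ℝ, F →L[ℝ] F)) (𝓘(ℝ, EM).prod 𝓘(ℝ, F' →L[ℝ] F'))
      S (twistorJ cov I) S' (twistorJ cov' I) f := fun p =>
  ⟨_, mobiusMap F F' A, isOpen_isInvertible_denom hA.smooth, hinv p p.2,
    fun _ hq => (contMDiffAt_mobiusMap hA.smooth _ hq).contMDiffWithinAt,
    fun q _ => (hf q).symm,
    fun X _ => mfderiv_mobiusMap_twistorJ hA p (hS p.2) (hinv p p.2) X⟩

/-- An isomorphism `A` of holomorphic bundles induces a biholomorphism of sets `S` and `S'` of complex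
structures as soon as the fractional linear maps of `A` and `A⁻¹` are defined on `S` and `S'` and
exchange these sets. -/
theorem exists_biholomorphism (hA : IsHolomorphicBundleIso cov cov' I A)
    {S : Set (EndTotal F V)} {S' : Set (EndTotal F' V')} (hS : S ⊆ twistorC F V)
    (hS' : S' ⊆ twistorC F' V')
    (hinj : ∀ p ∈ S, Function.Injective (denom (A p.proj) p.snd))
    (hinj' : ∀ p ∈ S', Function.Injective (denom (A p.proj).inverse p.snd))
    (hmem : ∀ p ∈ S, mobiusMap F F' A p ∈ S')
    (hmem' : ∀ p ∈ S', mobiusMap F' F (fun x => (A x).inverse) p ∈ S) :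
    ∃ Φ : S ≃ S', (∀ p, (Φ p : EndTotal F' V').proj = (p : EndTotal F V).proj) ∧
      IsInducedBy A Φ ∧
      IsBiholomorphism (𝓘(ℝ, EM).prod 𝓘(ℝ, F →L[ℝ] F)) (𝓘(ℝ, EM).prod 𝓘(ℝ, F' →L[ℝ] F'))
        S (twistorJ cov I) S' (twistorJ cov' I) Φ := by
  have hA' := hA.inverse
  have hinv : ∀ p ∈ S, (denom (A p.proj) p.snd).IsInvertible :=
    fun p hp => hA.isInvertible_denom (hinj p hp)
  have hinv' : ∀ p ∈ S', (denom (A p.proj).inverse p.snd).IsInvertible :=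
    fun p hp => hA'.isInvertible_denom (hinj' p hp)
  have hz : ∀ p ∈ S, zeroOneSpace (mobius (A p.proj) p.snd) = A p.proj '' zeroOneSpace p.snd :=
    fun p hp => zeroOneSpace_mobius (hA.complexLinear _) (hinv p hp) (hS hp)
  have hz' : ∀ p ∈ S', zeroOneSpace (mobius (A p.proj).inverse p.snd) =
      (A p.proj).inverse '' zeroOneSpace p.snd :=
    fun p hp => zeroOneSpace_mobius (hA'.complexLinear _) (hinv' p hp) (hS' hp)
  let Φ : S ≃ S' :=
    { toFun := fun p => ⟨mobiusMap F F' A p, hmem p p.2⟩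
      invFun := fun q => ⟨mobiusMap F' F (fun x => (A x).inverse) q, hmem' q q.2⟩
      left_inv := by
        rintro ⟨⟨x, J⟩, hp⟩
        have h1 := hmem _ hp
        have h2 := hmem' _ h1
        have h3 : mobius (A x).inverse (mobius (A x) J) = J := by
          refine eq_of_zeroOneSpace_eq (hS h2) (hS hp) ?_
          refine (hz' _ h1).trans ?_
          refine (congrArg (fun Z => (A x).inverse '' Z) (hz _ hp)).trans ?_
          rw [Set.image_image]
          simp [(hA.isInvertible x).inverse_apply_self]
        exact Subtype.ext (congrArg (TotalSpace.mk x) h3)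
      right_inv := by
        rintro ⟨⟨x, J⟩, hp⟩
        have h1 := hmem' _ hp
        have h2 := hmem _ h1
        have h3 : mobius (A x) (mobius (A x).inverse J) = J := by
          refine eq_of_zeroOneSpace_eq (hS' h2) (hS' hp) ?_
          refine (hz _ h1).trans ?_
          refine (congrArg (fun Z => A x '' Z) (hz' _ hp)).trans ?_
          rw [Set.image_image]
          simp [(hA.isInvertible x).self_apply_inverse]
        exact Subtype.ext (congrArg (TotalSpace.mk x) h3) }
  exact ⟨Φ, fun _ => rfl, fun p => ⟨_, rfl, hz p p.2⟩,
    isHolomorphic_mobiusMap hA hS hinv fun _ => rfl,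
    isHolomorphic_mobiusMap hA' hS' hinv' fun _ => rfl⟩

/-! ### Orthogonal complex structures -/

/-- Isotropy of the graph of an orthogonal `J`: the real part of `g (u + i J u, w + i J w) = 0`. -/
theorem metricC_graph {g : ContMDiffRiemannianMetric 𝓘(ℝ, EM) ∞ F V} {x : M} {J : V x →L[ℝ] V x}
    (hJ : ∀ u w, g.inner x (J u) (J w) = g.inner x u w) (u w : V x) :
    (metricC g x (u, J u) (w, J w)).re = 0 := by
  simp [metricC, hJ]

/-- The `-i` eigenspace of an orthogonal complex structure is isotropic, and so is its image under an
orthogonal map; as `g'` is positive definite, the image contains no vector `i b` with `b` real and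
nonzero. -/
theorem injective_denom_of_orthogonal {g : ContMDiffRiemannianMetric 𝓘(ℝ, EM) ∞ F V}
    {g' : ContMDiffRiemannianMetric 𝓘(ℝ, EM) ∞ F' V'} {x : M}
    {B : (V x × V x) →L[ℝ] (V' x × V' x)} (hB : Function.Injective B)
    (hg : ∀ u w, metricC g' x (B u) (B w) = metricC g x u w) {J : V x →L[ℝ] V x}
    (hJ : ∀ u w, g.inner x (J u) (J w) = g.inner x u w) :
    Function.Injective (denom B J) := by
  rw [injective_iff_map_eq_zero]
  intro u hu
  have h1 := metricC_graph hJ u u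
  rw [← hg, apply_graph, hu] at h1
  have h2 : numer B J u = 0 := by
    by_contra h3
    have h4 := g'.pos x _ h3
    simp only [metricC, map_zero, zero_apply, zero_sub] at h1
    linarith
  have h3 : B (u, J u) = B 0 := by rw [apply_graph, hu, h2, map_zero]; rfl
  exact congrArg Prod.fst (hB h3)

/-- The graph of `mobius B J` is isotropic, being the image of an isotropic space; this says that
`mobius B J` is orthogonal. -/
theorem mobius_orthogonal {g : ContMDiffRiemannianMetric 𝓘(ℝ, EM) ∞ F V}
    {g' : ContMDiffRiemannianMetric 𝓘(ℝ, EM) ∞ F' V'} {x : M}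
    {B : (V x × V x) →L[ℝ] (V' x × V' x)}
    (hg : ∀ u w, metricC g' x (B u) (B w) = metricC g x u w) {J : V x →L[ℝ] V x}
    (hJ : ∀ u w, g.inner x (J u) (J w) = g.inner x u w) (h : (denom B J).IsInvertible)
    (u w : V' x) : g'.inner x (mobius B J u) (mobius B J w) = g'.inner x u w := by
  obtain ⟨u, rfl⟩ := h.surjective u
  obtain ⟨w, rfl⟩ := h.surjective w
  have h1 := metricC_graph hJ u w
  rw [← hg, apply_graph, apply_graph] at h1
  simp only [metricC] at h1
  rw [mobius_denom h, mobius_denom h]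
  linarith

theorem mobiusMap_mem_twistorC (hA : IsHolomorphicBundleIso cov cov' I A) {p : EndTotal F V}
    (hp : p ∈ twistorC F V) (hinj : Function.Injective (denom (A p.proj) p.snd)) :
    mobiusMap F F' A p ∈ twistorC F' V' :=
  mobius_sq (hA.complexLinear _) (hA.isInvertible_denom hinj) hp

theorem mobiusMap_mem_twistorT (hA : IsHolomorphicBundleIso cov cov' I A)
    {g : ContMDiffRiemannianMetric 𝓘(ℝ, EM) ∞ F V}
    {g' : ContMDiffRiemannianMetric 𝓘(ℝ, EM) ∞ F' V'}
    (hg : ∀ x u w, metricC g' x (A x u) (A x w) = metricC g x u w) {p : EndTotal F V}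
    (hp : p ∈ twistorT g) : Function.Injective (denom (A p.proj) p.snd) ∧
      mobiusMap F F' A p ∈ twistorT g' := by
  have h := injective_denom_of_orthogonal (hA.bijective _).1 (hg _) hp.2
  exact ⟨h, mobiusMap_mem_twistorC hA hp.1 h,
    mobius_orthogonal (hg _) hp.2 (hA.isInvertible_denom h)⟩

end Biholomorphism

end TwistorSpaces

end

theorem mainTheorem6
    -- the complex manifold `(M, I)`
    {EM : Type*} [NormedAddCommGroup EM] [NormedSpace ℝ EM] [FiniteDimensional ℝ EM]
    {M : Type*} [TopologicalSpace M] [T2Space M] [SigmaCompactSpace M] [ChartedSpace EM M]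
    [IsManifold 𝓘(ℝ, EM) ∞ M]
    (I : Π x : M, TangentSpace 𝓘(ℝ, EM) x →L[ℝ] TangentSpace 𝓘(ℝ, EM) x)
    (hI : IsComplexStructure I)
    -- the smooth real vector bundle `E` of even rank, with its fibres `V x`
    {F : Type*} [NormedAddCommGroup F] [NormedSpace ℝ F] [FiniteDimensional ℝ F]
    {V : M → Type*} [TopologicalSpace (TotalSpace F V)]
    [∀ x, AddCommGroup (V x)] [∀ x, Module ℝ (V x)] [∀ x, TopologicalSpace (V x)]
    [∀ x, IsTopologicalAddGroup (V x)] [∀ x, ContinuousSMul ℝ (V x)]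
    [FiberBundle F V] [VectorBundle ℝ F V] [ContMDiffVectorBundle ∞ F V 𝓘(ℝ, EM)]
    (hF : Even (Module.finrank ℝ F))
    -- the second such bundle
    {F' : Type*} [NormedAddCommGroup F'] [NormedSpace ℝ F'] [FiniteDimensional ℝ F']
    {V' : M → Type*} [TopologicalSpace (TotalSpace F' V')]
    [∀ x, AddCommGroup (V' x)] [∀ x, Module ℝ (V' x)] [∀ x, TopologicalSpace (V' x)]
    [∀ x, IsTopologicalAddGroup (V' x)] [∀ x, ContinuousSMul ℝ (V' x)]
    [FiberBundle F' V'] [VectorBundle ℝ F' V'] [ContMDiffVectorBundle ∞ F' V' 𝓘(ℝ, EM)]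
    (hF' : Even (Module.finrank ℝ F'))
    -- smooth connections with curvature of type (1,1)
    (cov : CovariantDerivative 𝓘(ℝ, EM) F V) (cov' : CovariantDerivative 𝓘(ℝ, EM) F' V')
    (hcov : cov.ContMDiffCovariantDerivative ∞) (hcov' : cov'.ContMDiffCovariantDerivative ∞)
    (hR : HasCurvatureOneOne cov I) (hR' : HasCurvatureOneOne cov' I) :
    -- the twistor spaces of all complex structures on the fibres
    (∀ A : Π x : M, V x →L[ℝ] V' x,
      ContMDiff 𝓘(ℝ, EM) (𝓘(ℝ, EM).prod 𝓘(ℝ, F →L[ℝ] F')) ∞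
        (fun x => TotalSpace.mk' (F →L[ℝ] F') (E := fun x => V x →L[ℝ] V' x) x (A x)) →
      IsHolomorphicBundleIso cov cov' I (fun x => (A x).prodMap (A x)) →
      ∃ Φ : twistorC F V ≃ twistorC F' V',
        (∀ p, (Φ p : EndTotal F' V').proj = (p : EndTotal F V).proj) ∧
        IsInducedBy (fun x => (A x).prodMap (A x)) Φ ∧
        IsBiholomorphism (𝓘(ℝ, EM).prod 𝓘(ℝ, F →L[ℝ] F)) (𝓘(ℝ, EM).prod 𝓘(ℝ, F' →L[ℝ] F'))
          (twistorC F V) (twistorJ cov I) (twistorC F' V') (twistorJ cov' I) Φ) ∧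
    -- the twistor spaces of orthogonal complex structures on the fibres
    (∀ (g : ContMDiffRiemannianMetric 𝓘(ℝ, EM) ∞ F V)
      (g' : ContMDiffRiemannianMetric 𝓘(ℝ, EM) ∞ F' V'),
      IsMetricConnection cov g → IsMetricConnection cov' g' →
      ∀ A : Π x : M, (V x × V x) →L[ℝ] (V' x × V' x),
      IsHolomorphicBundleIso cov cov' I A →
      (∀ x u w, metricC g' x (A x u) (A x w) = metricC g x u w) →
      ∃ Φ : twistorT g ≃ twistorT g',
        (∀ p, (Φ p : EndTotal F' V').proj = (p : EndTotal F V).proj) ∧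
        IsInducedBy A Φ ∧
        IsBiholomorphism (𝓘(ℝ, EM).prod 𝓘(ℝ, F →L[ℝ] F)) (𝓘(ℝ, EM).prod 𝓘(ℝ, F' →L[ℝ] F'))
          (twistorT g) (twistorJ cov I) (twistorT g') (twistorJ cov' I) Φ) := by
  refine ⟨fun A _ hA => ?_, fun g g' _ _ A hA hg => ?_⟩
  · have hinj : ∀ x, Function.Injective (A x) := fun x a b hab => by
      have h : (A x).prodMap (A x) (a, 0) = (A x).prodMap (A x) (b, 0) :=
        Prod.ext hab rfl
      exact congrArg Prod.fst ((hA.bijective x).1 h)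
    -- If `A⁻¹ (u, J' u) = (0, b)`, then `(u, J' u) = (A 0, A b)`, as `A` is real.
    have hinj' : ∀ p ∈ twistorC F' V',
        Function.Injective (denom ((A p.proj).prodMap (A p.proj)).inverse p.snd) := by
      intro p _
      rw [injective_iff_map_eq_zero]
      intro u hu
      have h1 := apply_graph ((A p.proj).prodMap (A p.proj)).inverse p.snd u
      rw [hu, (hA.isInvertible p.proj).inverse_apply_eq] at h1
      exact (congrArg Prod.fst h1).trans (map_zero (A p.proj))
    exact exists_biholomorphism hA subset_rfl subset_rfl (fun p _ => hinj p.proj) hinj'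
      (fun p hp => mobiusMap_mem_twistorC hA hp (hinj p.proj))
      (fun p hp => mobiusMap_mem_twistorC hA.inverse hp (hinj' p hp))
  · have hg' : ∀ x u w, metricC g x ((A x).inverse u) ((A x).inverse w) = metricC g' x u w := by
      intro x u w
      rw [← hg, (hA.isInvertible x).self_apply_inverse, (hA.isInvertible x).self_apply_inverse]
    exact exists_biholomorphism hA (fun p hp => hp.1) (fun p hp => hp.1)
      (fun p hp => (mobiusMap_mem_twistorT hA hg hp).1)
      (fun p hp => (mobiusMap_mem_twistorT hA.inverse hg' hp).1)
      (fun p hp => (mobiusMap_mem_twistorT hA hg hp).2)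
      (fun p hp => (mobiusMap_mem_twistorT hA.inverse hg' hp).2)
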